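/- Theorem (Littlewood duality). Let $K$ be a field of characteristic $0$, let $Sym$ be the ring of symmetric functions over $K$ (symmetric formal power series of bounded degree in countably many variables), and let $\widehat{Sym}$ be its completion with respect to the degree (symmetric formal power series of arbitrary degree). Let $p_k$ and $h_k$ be the power sums and the complete homogeneous symmetric functions, put $\sigma_1=\sum_{n\ge 0}h_n\in\widehat{Sym}$, and let $\langle\cdot,\cdot\rangle$ be the Hall scalar product, $\langle p_\lambda,p_\mu\rangle=z_\lambda\delta_{\lambda\mu}$, extended to pairs of elements of $\widehat{Sym}$ at least one of which lies in $Sym$. For $f=P(p_1,p_2,\dots)\in Sym$, with $P$ a polynomial, and $G\in\widehat{Sym}$, the outer plethysm is $f[G]=P(p_1[G],p_2[G],\dots)$, where $p_k[G]=G(x_1^k,x_2^k,\dots)$. For $f=P(p_1,p_2,\dots)\in Sym$ and a class function $\xi$ on the symmetric group $\mathfrak S_n$, put $f(\xi)=P(\psi^1(\xi),\psi^2(\xi),\dots)$, where $\psi^k(\xi)(\tau)=\xi(\tau^k)$ and class functions are multiplied pointwise. (If $\xi$ is the character of a representation, $h_k(\xi)$ and $e_k(\xi)$ are the characters of its $k$-th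 symmetric and exterior powers.) For $F=\sum_n F_n\in\widehat{Sym}$ with $F_n$ homogeneous of degree $n$, let $\xi_n$ be the class function on $\mathfrak S_n$ with Frobenius characteristic $\mathrm{ch}(\xi_n)=\frac1{n!}\sum_{\tau\in\mathfrak S_n}\xi_n(\tau)\,p_{\mathrm{type}(\tau)}=F_n$. The inner plethysm is $\hat f[F]=\sum_n \mathrm{ch}(f(\xi_n))$. Then for any two symmetric functions $f,g\in Sym$, $$\langle \hat f[\sigma_1h_1],\,g\rangle=\langle f,\,g[\sigma_1]\rangle .$$ Here $\sigma_1h_1=\sum_{n\ge 1}h_{n-1}h_1$ is the series whose component of degree $n$ is the Frobenius characteristic of the permutation representation of $\mathfrak S_n$ on $K^n$. -/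

import Mathlib

/-! Symmetric functions over a field `K` of characteristic zero in the variables `x₀, x₁, x₂, …`,
their completion, the Hall scalar product, outer plethysm and inner plethysm. -/

noncomputable section

/-- Symmetric formal power series in countably many variables (no restriction on degrees): the
completion of the ring of symmetric functions with respect to the degree. -/
def SymSeries (K : Type*) [Field K] : Subalgebra K (MvPowerSeries ℕ K) where
  carrier := {F | ∀ π : Equiv.Perm ℕ, MvPowerSeries.rename π F = F}
  mul_mem' hF hG π := by rw [map_mul, hF π, hG π]
  add_mem' hF hG π := by rw [map_add, hF π, hG π]
  algebraMap_mem' r π := by rw [AlgHom.commutes]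

/-- The ring `Sym` of symmetric functions: symmetric formal power series of bounded degree. -/
def SymFun (K : Type*) [Field K] : Subalgebra K (MvPowerSeries ℕ K) where
  carrier := {F | F ∈ SymSeries K ∧
    ∃ N : ℕ, ∀ d : ℕ →₀ ℕ, N < d.degree → MvPowerSeries.coeff d F = 0}
  mul_mem' := by
    classical
    rintro F G ⟨hF, N, hN⟩ ⟨hG, M, hM⟩
    refine ⟨mul_mem hF hG, N + M, fun d hd => ?_⟩
    rw [MvPowerSeries.coeff_mul]
    refine Finset.sum_eq_zero fun ab hab => ?_
    have hab := Finset.HasAntidiagonal.mem_antidiagonal.1 hab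
    have h : ab.1.degree + ab.2.degree = d.degree := by rw [← hab, map_add]
    rcases lt_or_ge N ab.1.degree with h1 | h1
    · rw [hN _ h1, zero_mul]
    · rw [hM _ (by omega), mul_zero]
  add_mem' := by
    rintro F G ⟨hF, N, hN⟩ ⟨hG, M, hM⟩
    refine ⟨add_mem hF hG, max N M, fun d hd => ?_⟩
    rw [map_add, hN d (lt_of_le_of_lt (le_max_left _ _) hd),
      hM d (lt_of_le_of_lt (le_max_right _ _) hd), add_zero]
  algebraMap_mem' r := by
    classical
    refine ⟨(SymSeries K).algebraMap_mem r, 0, fun d hd => ?_⟩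
    rw [MvPowerSeries.algebraMap_apply, MvPowerSeries.coeff_C, if_neg]
    rintro rfl
    simp at hd

namespace SymFun

variable {K : Type*} [Field K]

/-- A symmetric function seen in the completion. -/
def toSeries : SymFun K →ₐ[K] SymSeries K :=
  Subalgebra.inclusion fun _ hF => hF.1

end SymFun

theorem mem_symSeries_iff {K : Type*} [Field K] (F : MvPowerSeries ℕ K) :
    F ∈ SymSeries K ↔ ∀ (π : Equiv.Perm ℕ) (d : ℕ →₀ ℕ),
      MvPowerSeries.coeff (d.mapDomain π) F = MvPowerSeries.coeff d F := by
  have key : ∀ (π : Equiv.Perm ℕ) (d : ℕ →₀ ℕ),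
      MvPowerSeries.coeff (d.mapDomain π) (MvPowerSeries.rename π F) =
        MvPowerSeries.coeff d F := fun π d => by
    have := MvPowerSeries.coeff_embDomain_rename (R := K) π.toEmbedding F d
    rwa [Finsupp.embDomain_eq_mapDomain] at this
  constructor
  · intro h π d
    have := key π d
    rwa [h π] at this
  · intro h π
    ext d
    obtain ⟨e, rfl⟩ : ∃ e : ℕ →₀ ℕ, d = e.mapDomain π :=
      ⟨d.mapDomain π.symm, by rw [← Finsupp.mapDomain_comp]; simp⟩
    rw [key, h]

/-- The formal power series whose coefficient of the monomial `xᵈ` is `c d`. -/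
def ofCoeff {K : Type*} (c : (ℕ →₀ ℕ) → K) : MvPowerSeries ℕ K := c

theorem coeff_ofCoeff {K : Type*} [Field K] (c : (ℕ →₀ ℕ) → K) (d : ℕ →₀ ℕ) :
    MvPowerSeries.coeff d (ofCoeff c) = c d := rfl

namespace SymSeries

variable {K : Type*} [Field K]

/-- The symmetric series `∑ₙ Aₙ`, where only the part of degree `n` of the `n`-th term `A n` is
used: the series whose homogeneous component of degree `n` is that of `A n`. -/
def ofComponents (A : ℕ → SymFun K) : SymSeries K :=
  ⟨ofCoeff fun d => MvPowerSeries.coeff d (A d.degree : MvPowerSeries ℕ K), by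
    rw [mem_symSeries_iff]
    intro π d
    rw [coeff_ofCoeff, coeff_ofCoeff, Finsupp.degree_mapDomain, (mem_symSeries_iff _).1 (A d.degree).2.1]⟩

/-- The homogeneous component of degree `n`. -/
def homogComp (n : ℕ) (F : SymSeries K) : SymFun K :=
  ⟨ofCoeff fun d => if d.degree = n then MvPowerSeries.coeff d (F : MvPowerSeries ℕ K) else 0, by
    refine ⟨?_, n, fun d hd => if_neg hd.ne'⟩
    rw [mem_symSeries_iff]
    intro π d
    rw [coeff_ofCoeff, coeff_ofCoeff, Finsupp.degree_mapDomain, (mem_symSeries_iff _).1 F.2]⟩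

/-- The operation `F ↦ F(x₀ᵏ, x₁ᵏ, …)`, that is, the outer plethysm `p_k[F]`. -/
def powerSubst (k : ℕ+) (F : SymSeries K) : SymSeries K :=
  ⟨MvPowerSeries.expand (k : ℕ) k.ne_zero (F : MvPowerSeries ℕ K), by
    have hF := (mem_symSeries_iff _).1 F.2
    rw [mem_symSeries_iff]
    have hdiv : ∀ (π : Equiv.Perm ℕ) (d : ℕ →₀ ℕ), (∃ i, ¬ (k : ℕ) ∣ d i) →
        MvPowerSeries.coeff (d.mapDomain π)
          (MvPowerSeries.expand (k : ℕ) k.ne_zero (F : MvPowerSeries ℕ K)) = 0 := by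
      rintro π d ⟨i, hi⟩
      refine MvPowerSeries.coeff_expand_of_not_dvd (i := π i) _ _ _ ?_
      rwa [Finsupp.mapDomain_apply π.injective]
    intro π d
    by_cases h : ∃ i, ¬ (k : ℕ) ∣ d i
    · have h1 := hdiv (Equiv.refl ℕ) d h
      rw [hdiv π d h]
      simpa using h1.symm
    · push Not at h
      obtain ⟨e, rfl⟩ : ∃ e : ℕ →₀ ℕ, d = (k : ℕ) • e :=
        ⟨d.mapRange (· / (k : ℕ)) (Nat.zero_div _), by
          ext i; simp [Nat.mul_div_cancel' (h i)]⟩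
      rw [Finsupp.mapDomain_smul, MvPowerSeries.coeff_expand_smul,
        MvPowerSeries.coeff_expand_smul, hF]⟩

end SymSeries

namespace SymFun

/-- The power sum `p_k = ∑ᵢ xᵢᵏ` (used for `k ≥ 1` only). -/
def psum (K : Type*) [Field K] (k : ℕ) : SymFun K :=
  ⟨ofCoeff fun d => by classical exact if ∃ i, d = Finsupp.single i k then 1 else 0, by
    classical
    refine ⟨?_, k, fun d hd => if_neg ?_⟩
    · rw [mem_symSeries_iff]
      intro π d
      rw [coeff_ofCoeff, coeff_ofCoeff]
      refine if_congr ⟨?_, ?_⟩ rfl rfl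
      · rintro ⟨i, hi⟩
        refine ⟨π.symm i, Finsupp.mapDomain_injective π.injective ?_⟩
        rw [hi, Finsupp.mapDomain_single, Equiv.apply_symm_apply]
      · rintro ⟨i, rfl⟩
        exact ⟨π i, by rw [Finsupp.mapDomain_single]⟩
    · rintro ⟨i, rfl⟩
      simp at hd⟩

/-- The complete homogeneous symmetric function `h_n`, the sum of all monomials of degree `n`. -/
def hsymm (K : Type*) [Field K] (n : ℕ) : SymFun K :=
  ⟨ofCoeff fun d => if d.degree = n then 1 else 0, by
    refine ⟨?_, n, fun d hd => if_neg hd.ne'⟩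
    rw [mem_symSeries_iff]
    intro π d
    rw [coeff_ofCoeff, coeff_ofCoeff, Finsupp.degree_mapDomain]⟩

end SymFun

/-- The series `σ₁ = ∑_{n ≥ 0} h_n`. -/
def sigmaOne (K : Type*) [Field K] : SymSeries K :=
  SymSeries.ofComponents (SymFun.hsymm K)

/-! ### The power sums freely generate the ring of symmetric functions -/

section FundamentalTheorem

variable (K : Type*) [Field K]

/-- The substitution `P ↦ P(p₁, p₂, p₃, …)`. -/
def powerSumHom : MvPolynomial ℕ+ K →ₐ[K] SymFun K :=
  MvPolynomial.aeval fun k : ℕ+ => SymFun.psum K k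

/-- The same in `N` variables, with the first `N` power sums. -/
def finPowerSumHom (N : ℕ) :
    MvPolynomial (Fin N) K →ₐ[K] MvPolynomial.symmetricSubalgebra (Fin N) K :=
  MvPolynomial.aeval fun i : Fin N =>
    ⟨MvPolynomial.psum (Fin N) K (i + 1), MvPolynomial.psum_isSymmetric _ _ _⟩

theorem finPowerSumHom_coe (N : ℕ) (P : MvPolynomial (Fin N) K) :
    (finPowerSumHom K N P : MvPolynomial (Fin N) K) =
      MvPolynomial.aeval (fun i : Fin N => MvPolynomial.psum (Fin N) K (i + 1)) P :=
  (Subalgebra.mvPolynomial_aeval_coe _ _ _).symm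

theorem esymm_mem_range_aeval_psum [CharZero K] (N k : ℕ) (hk : k ≤ N) :
    MvPolynomial.esymm (Fin N) K k ∈
      (MvPolynomial.aeval (R := K)
        (fun i : Fin N => MvPolynomial.psum (Fin N) K (i + 1))).range := by
  induction k using Nat.strong_induction_on with
  | _ k ih =>
    rcases Nat.eq_zero_or_pos k with rfl | hpos
    · rw [MvPolynomial.esymm_zero]; exact one_mem _
    have hN := MvPolynomial.mul_esymm_eq_sum (Fin N) K k
    have hk0 : (k : K) ≠ 0 := by exact_mod_cast hpos.ne'
    have hE : MvPolynomial.esymm (Fin N) K k =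
        (k : K)⁻¹ • ((k : MvPolynomial (Fin N) K) * MvPolynomial.esymm (Fin N) K k) := by
      rw [← nsmul_eq_mul, ← Nat.cast_smul_eq_nsmul K, smul_smul, inv_mul_cancel₀ hk0, one_smul]
    rw [hE, hN]
    refine Subalgebra.smul_mem _ (mul_mem (pow_mem (neg_mem (one_mem _)) _) (sum_mem ?_)) _
    intro a ha
    rw [Finset.mem_filter, Finset.HasAntidiagonal.mem_antidiagonal] at ha
    refine mul_mem (mul_mem (pow_mem (neg_mem (one_mem _)) _) (ih _ ha.2 (by omega))) ?_
    refine ⟨MvPolynomial.X ⟨a.2 - 1, by omega⟩, ?_⟩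
    have : a.2 - 1 + 1 = a.2 := by omega
    simp [this]

theorem finPowerSumHom_surjective [CharZero K] (N : ℕ) :
    Function.Surjective (finPowerSumHom K N) := by
  intro f
  obtain ⟨P, rfl⟩ :=
    MvPolynomial.esymmAlgHom_surjective (σ := Fin N) K (n := N) (by simp) f
  suffices h : MvPolynomial.esymmAlgHom (Fin N) K N P ∈ (finPowerSumHom K N).range from h
  induction P using MvPolynomial.induction_on with
  | C a => exact ⟨MvPolynomial.C a, by simp [finPowerSumHom, MvPolynomial.esymmAlgHom]⟩
  | add p q hp hq => rw [map_add]; exact add_mem hp hq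
  | mul_X p i hp =>
    rw [map_mul]
    refine mul_mem hp ?_
    obtain ⟨Q, hQ⟩ := esymm_mem_range_aeval_psum K N (i + 1) i.2
    refine ⟨Q, Subtype.ext ?_⟩
    change (finPowerSumHom K N Q : MvPolynomial (Fin N) K) = _
    rw [finPowerSumHom_coe]
    exact hQ.trans (by simp [MvPolynomial.esymmAlgHom])

theorem finPowerSumHom_injective [CharZero K] (N : ℕ) :
    Function.Injective (finPowerSumHom K N) := by
  set e := MvPolynomial.esymmAlgEquiv (Fin N) K (n := N) (by simp)
  let φ : MvPolynomial (Fin N) K →ₐ[K] MvPolynomial (Fin N) K :=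
    (e.symm : _ →ₐ[K] _).comp (finPowerSumHom K N)
  have hs : Function.Surjective φ := e.symm.surjective.comp (finPowerSumHom_surjective K N)
  have hi : Function.Injective φ := by
    rw [injective_iff_map_eq_zero]
    intro x hx
    have hmono : Monotone fun n : ℕ => RingHom.ker (φ ^ n) := by
      refine monotone_nat_of_le_succ fun n y hy => ?_
      rw [RingHom.mem_ker] at hy ⊢
      rw [pow_succ', AlgHom.mul_apply, hy, map_zero]
    obtain ⟨n, hn⟩ := monotone_stabilizes_iff_noetherian.2
      (inferInstance : IsNoetherian (MvPolynomial (Fin N) K) (MvPolynomial (Fin N) K))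
      ⟨_, hmono⟩
    obtain ⟨y, rfl⟩ : ∃ y, (φ ^ n) y = x := by
      rw [AlgHom.coe_pow]; exact hs.iterate n x
    have hy : y ∈ RingHom.ker (φ ^ (n + 1)) := by
      rw [RingHom.mem_ker, pow_succ', AlgHom.mul_apply, hx]
    have hk : RingHom.ker (φ ^ n) = RingHom.ker (φ ^ (n + 1)) := hn (n + 1) n.le_succ
    rw [← hk] at hy
    exact hy
  exact Function.Injective.of_comp (f := e.symm) hi

/-- Setting all but the first `N` variables to zero. -/
def restrictVars (N : ℕ) : MvPowerSeries ℕ K →ₐ[K] MvPowerSeries (Fin N) K :=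
  MvPowerSeries.killCompl Fin.valEmbedding

theorem restrictVars_psum (N k : ℕ) (hk : k ≠ 0) :
    restrictVars K N (SymFun.psum K k : MvPowerSeries ℕ K) =
      (MvPolynomial.psum (Fin N) K k : MvPowerSeries (Fin N) K) := by
  classical
  ext d
  rw [restrictVars, MvPowerSeries.coeff_killCompl, MvPolynomial.coeff_coe]
  change (if ∃ i, d.embDomain Fin.valEmbedding = Finsupp.single i k then (1 : K) else 0) = _
  simp only [MvPolynomial.psum, MvPolynomial.coeff_sum, MvPolynomial.coeff_X_pow]
  by_cases h : ∃ i, Finsupp.single i k = d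
  · obtain ⟨i, rfl⟩ := h
    rw [if_pos ⟨i, by simp⟩, Finset.sum_eq_single i]
    · simp
    · intro j _ hj
      rw [if_neg]
      intro he
      exact hj ((Finsupp.single_left_inj hk).1 he)
    · simp
  · rw [if_neg, Finset.sum_eq_zero]
    · intro i _
      exact if_neg fun he => h ⟨i, he⟩
    · rintro ⟨i, hi⟩
      have hm : i ∈ (d.embDomain Fin.valEmbedding).support := by
        rw [hi]; simp [hk]
      rw [Finsupp.support_embDomain, Finset.mem_map] at hm
      obtain ⟨j, -, rfl⟩ := hm
      refine h ⟨j, Finsupp.embDomain_injective Fin.valEmbedding ?_⟩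
      rw [hi, Finsupp.embDomain_single]

/-- The inclusion of the first `N` power sum indices. -/
def succPNatFin (N : ℕ) (i : Fin N) : ℕ+ := ⟨i + 1, Nat.succ_pos _⟩

theorem restrictVars_powerSumHom (N : ℕ) (P : MvPolynomial (Fin N) K) :
    restrictVars K N
        (powerSumHom K (MvPolynomial.rename (succPNatFin N) P) : MvPowerSeries ℕ K) =
      ((finPowerSumHom K N P : MvPolynomial (Fin N) K) : MvPowerSeries (Fin N) K) := by
  induction P using MvPolynomial.induction_on with
  | C a =>
    simp only [powerSumHom, finPowerSumHom, MvPolynomial.rename_C, MvPolynomial.aeval_C,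
      Subalgebra.coe_algebraMap, AlgHom.commutes]
    rw [MvPolynomial.algebraMap_eq, MvPolynomial.coe_C, MvPowerSeries.algebraMap_apply,
      Algebra.algebraMap_self, RingHom.id_apply]
  | add p q hp hq => simp only [map_add, AddMemClass.coe_add, hp, hq, MvPolynomial.coe_add]
  | mul_X p i hp =>
    simp only [map_mul, MulMemClass.coe_mul, hp, MvPolynomial.coe_mul]
    congr 1
    simp only [powerSumHom, finPowerSumHom, MvPolynomial.rename_X, MvPolynomial.aeval_X]
    exact restrictVars_psum K N (i + 1) (Nat.succ_ne_zero _)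

theorem powerSumHom_injective [CharZero K] : Function.Injective (powerSumHom K) := by
  rw [injective_iff_map_eq_zero]
  intro P hP
  obtain ⟨N, hN⟩ : ∃ N : ℕ, ∀ k ∈ P.vars, (k : ℕ) ≤ N :=
    ⟨P.vars.sup fun k : ℕ+ => (k : ℕ), fun k hk => Finset.le_sup (f := fun k : ℕ+ => (k : ℕ)) hk⟩
  obtain ⟨Q, rfl⟩ := MvPolynomial.exists_rename_eq_of_vars_subset_range P (succPNatFin N)
    (fun i j h => Fin.ext (Nat.succ_injective (congrArg PNat.val h)))
    (fun k hk => ⟨⟨k - 1, by have := hN k hk; have := k.pos; omega⟩,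
      PNat.eq (Nat.sub_add_cancel k.pos)⟩)
  have h := restrictVars_powerSumHom K N Q
  rw [hP] at h
  have h0 : (finPowerSumHom K N Q : MvPolynomial (Fin N) K) = 0 := by
    apply MvPolynomial.coe_injective
    rw [← h]; simp
  have : Q = 0 := finPowerSumHom_injective K N (Subtype.ext (by rw [h0, map_zero]; rfl))
  rw [this, map_zero]

/-- A symmetric series of degree at most `N` is determined by its restriction to `N` variables. -/
theorem eq_zero_of_restrictVars_eq_zero (N : ℕ) (F : MvPowerSeries ℕ K) (hF : F ∈ SymSeries K)
    (hN : ∀ d : ℕ →₀ ℕ, N < d.degree → MvPowerSeries.coeff d F = 0)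
    (h0 : restrictVars K N F = 0) : F = 0 := by
  classical
  ext d
  rw [map_zero]
  rcases lt_or_ge N d.degree with hd | hd
  · exact hN d hd
  have hcard : d.support.card ≤ N := by
    refine le_trans ?_ hd
    rw [Finsupp.degree_apply, Finset.card_eq_sum_ones]
    exact Finset.sum_le_sum fun i hi => Nat.one_le_iff_ne_zero.2 (Finsupp.mem_support_iff.1 hi)
  obtain ⟨π, hπ⟩ : ∃ π : Equiv.Perm ℕ, ∀ i ∈ d.support, π i < N := by
    obtain ⟨π, hπ⟩ := (Equiv.Perm.isMultiplyPretransitive ℕ d.support.card).exists_smul_eq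
      (d.support.equivFin.symm.toEmbedding.trans (Function.Embedding.subtype _))
      (Fin.valEmbedding)
    refine ⟨π, fun i hi => ?_⟩
    have := DFunLike.congr_fun hπ (d.support.equivFin ⟨i, hi⟩)
    have h3 : π i = (d.support.equivFin ⟨i, hi⟩ : ℕ) := by
      rw [Function.Embedding.smul_apply] at this
      simpa [Equiv.Perm.smul_def] using this
    rw [h3]
    exact lt_of_lt_of_le (Fin.is_lt _) hcard
  rw [← (mem_symSeries_iff F).1 hF π d]
  have hr : ∀ i ∈ (d.mapDomain π).support, i ∈ Set.range (Fin.valEmbedding : Fin N ↪ ℕ) := by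
    intro i hi
    obtain ⟨j, hj, rfl⟩ := Finset.mem_image.1 (Finsupp.mapDomain_support hi)
    exact ⟨⟨π j, hπ j hj⟩, rfl⟩
  obtain ⟨e, he⟩ : ∃ e : Fin N →₀ ℕ, e.embDomain Fin.valEmbedding = d.mapDomain π := by
    refine ⟨(d.mapDomain π).comapDomain Fin.valEmbedding (Fin.valEmbedding.injective.injOn), ?_⟩
    rw [Finsupp.embDomain_eq_mapDomain]
    exact Finsupp.mapDomain_comapDomain _ Fin.valEmbedding.injective _ hr
  rw [← he]
  have := congrArg (MvPowerSeries.coeff e) h0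
  rwa [restrictVars, MvPowerSeries.coeff_killCompl, map_zero] at this

/-- In `N` variables, a symmetric polynomial of degree at most `N` is a polynomial in the power
sums involving only monomials of weight at most `N`. -/
theorem exists_finPowerSumHom_eq [CharZero K] (N : ℕ) (f : MvPolynomial (Fin N) K)
    (hf : f.IsSymmetric) (hN : ∀ d : Fin N →₀ ℕ, N < d.degree → f.coeff d = 0) :
    ∃ P : MvPolynomial (Fin N) K, (finPowerSumHom K N P : MvPolynomial (Fin N) K) = f ∧
      ∀ m ∈ P.support, (m.sum fun i e => e * ((i : ℕ) + 1)) ≤ N := by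
  classical
  obtain ⟨P, hP⟩ := finPowerSumHom_surjective K N ⟨f, hf⟩
  have hP' : (finPowerSumHom K N P : MvPolynomial (Fin N) K) = f := congrArg Subtype.val hP
  let wt : (Fin N →₀ ℕ) → ℕ := fun m => m.sum fun i e => e * ((i : ℕ) + 1)
  have hom : ∀ (m : Fin N →₀ ℕ) (c : K),
      (finPowerSumHom K N (MvPolynomial.monomial m c) : MvPolynomial (Fin N) K).IsHomogeneous
        (wt m) := by
    intro m c
    rw [finPowerSumHom_coe, MvPolynomial.aeval_monomial, MvPolynomial.algebraMap_eq]
    have h1 := MvPolynomial.IsHomogeneous.prod m.support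
      (fun i : Fin N => MvPolynomial.psum (Fin N) K (i + 1) ^ m i)
      (fun i => ((i : ℕ) + 1) * m i) (fun i _ => by
        refine MvPolynomial.IsHomogeneous.pow ?_ _
        refine MvPolynomial.IsHomogeneous.sum _ _ _ fun j _ => ?_
        simpa using (MvPolynomial.isHomogeneous_X K j).pow ((i : ℕ) + 1))
    have h2 := (MvPolynomial.isHomogeneous_C (Fin N) c).mul h1
    have he : wt m = 0 + ∑ i ∈ m.support, ((i : ℕ) + 1) * m i := by
      simp only [wt, Finsupp.sum, zero_add, mul_comm]
    rw [he]
    exact h2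
  let S := P.support.filter fun m => wt m ≤ N
  let T := P.support.filter fun m => ¬ wt m ≤ N
  refine ⟨∑ m ∈ S, MvPolynomial.monomial m (P.coeff m), ?_, ?_⟩
  · have hsplit : P = (∑ m ∈ S, MvPolynomial.monomial m (P.coeff m)) +
        ∑ m ∈ T, MvPolynomial.monomial m (P.coeff m) := by
      rw [Finset.sum_filter_add_sum_filter_not]
      exact P.as_sum
    ext d
    rw [← hP']
    conv_rhs => rw [hsplit]
    rw [map_add, AddMemClass.coe_add, MvPolynomial.coeff_add]
    have coeff_zero : ∀ (U : Finset (Fin N →₀ ℕ)), (∀ m ∈ U, wt m ≠ d.degree) →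
        MvPolynomial.coeff d ((finPowerSumHom K N
          (∑ m ∈ U, MvPolynomial.monomial m (P.coeff m)) :
            MvPolynomial.symmetricSubalgebra (Fin N) K) : MvPolynomial (Fin N) K) = 0 := by
      intro U hU
      rw [map_sum, AddSubmonoidClass.coe_finsetSum, MvPolynomial.coeff_sum]
      refine Finset.sum_eq_zero fun m hm => ?_
      exact (hom m _).coeff_eq_zero fun h => hU m hm h.symm
    rcases lt_or_ge N d.degree with hd | hd
    · have h1 := coeff_zero S fun m hm => by
        have := (Finset.mem_filter.1 hm).2; omega
      have h2 := hN d hd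
      rw [← hP'] at h2
      conv_lhs at h2 => rw [hsplit]
      rw [map_add, AddMemClass.coe_add, MvPolynomial.coeff_add] at h2
      rw [h2, h1]
    · rw [coeff_zero T fun m hm => by have := (Finset.mem_filter.1 hm).2; omega, add_zero]
  · intro m hm
    rw [MvPolynomial.mem_support_iff, MvPolynomial.coeff_sum] at hm
    obtain ⟨m', hm', hne⟩ := Finset.exists_ne_zero_of_sum_ne_zero hm
    rw [MvPolynomial.coeff_monomial] at hne
    have : m' = m := by by_contra h; exact hne (if_neg h)
    subst this
    exact (Finset.mem_filter.1 hm').2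

theorem coeff_mul_eq_zero_of_lt {F G : MvPowerSeries ℕ K} {a b : ℕ}
    (hF : ∀ d : ℕ →₀ ℕ, a < d.degree → MvPowerSeries.coeff d F = 0)
    (hG : ∀ d : ℕ →₀ ℕ, b < d.degree → MvPowerSeries.coeff d G = 0)
    (d : ℕ →₀ ℕ) (hd : a + b < d.degree) : MvPowerSeries.coeff d (F * G) = 0 := by
  classical
  rw [MvPowerSeries.coeff_mul]
  refine Finset.sum_eq_zero fun ab hab => ?_
  have hab := Finset.HasAntidiagonal.mem_antidiagonal.1 hab
  have h : ab.1.degree + ab.2.degree = d.degree := by rw [← hab, map_add]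
  rcases lt_or_ge a ab.1.degree with h1 | h1
  · rw [hF _ h1, zero_mul]
  · rw [hG _ (by omega), mul_zero]

theorem coeff_powerSumHom_monomial_eq_zero (N : ℕ) (m : Fin N →₀ ℕ) (c : K) (d : ℕ →₀ ℕ)
    (hd : (m.sum fun i e => e * ((i : ℕ) + 1)) < d.degree) :
    MvPowerSeries.coeff d (powerSumHom K (MvPolynomial.rename (succPNatFin N)
      (MvPolynomial.monomial m c)) : MvPowerSeries ℕ K) = 0 := by
  classical
  induction m using Finsupp.induction_linear generalizing c d with
  | zero =>
    rw [← MvPolynomial.C_apply, MvPolynomial.rename_C, ← MvPolynomial.algebraMap_eq,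
      AlgHom.commutes, Subalgebra.coe_algebraMap, MvPowerSeries.algebraMap_apply,
      MvPowerSeries.coeff_C, if_neg]
    rintro rfl
    simp at hd
  | add m n hm hn =>
    rw [Finsupp.sum_add_index' (by simp) (by intros; ring)] at hd
    have : MvPolynomial.monomial (m + n) c =
        MvPolynomial.monomial m c * MvPolynomial.monomial n (1 : K) := by
      rw [MvPolynomial.monomial_mul, mul_one]
    rw [this, map_mul, map_mul, MulMemClass.coe_mul]
    exact coeff_mul_eq_zero_of_lt K (fun d h => hm c d h) (fun d h => hn 1 d h) d hd
  | single i e =>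
    rw [Finsupp.sum_single_index (by simp)] at hd
    induction e generalizing c d with
    | zero =>
      rw [Finsupp.single_zero, ← MvPolynomial.C_apply, MvPolynomial.rename_C,
        ← MvPolynomial.algebraMap_eq,
        AlgHom.commutes, Subalgebra.coe_algebraMap, MvPowerSeries.algebraMap_apply,
        MvPowerSeries.coeff_C, if_neg]
      rintro rfl
      simp at hd
    | succ e ih =>
      have : MvPolynomial.monomial (Finsupp.single i (e + 1)) c =
          MvPolynomial.monomial (Finsupp.single i e) c * MvPolynomial.X i := by
        rw [MvPolynomial.X, MvPolynomial.monomial_mul, mul_one, Finsupp.single_add]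
      rw [this, map_mul, map_mul, MulMemClass.coe_mul]
      refine coeff_mul_eq_zero_of_lt K (a := e * ((i : ℕ) + 1)) (b := (i : ℕ) + 1)
        (fun d h => ih c d h) (fun d h => ?_) d (by linarith)
      rw [MvPolynomial.rename_X, powerSumHom, MvPolynomial.aeval_X]
      refine if_neg ?_
      rintro ⟨j, rfl⟩
      simp [succPNatFin] at h

theorem powerSumHom_surjective [CharZero K] : Function.Surjective (powerSumHom K) := by
  classical
  rintro ⟨F, hF, N, hN⟩
  have hcoeff : ∀ d : Fin N →₀ ℕ, MvPowerSeries.coeff d (restrictVars K N F) =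
      MvPowerSeries.coeff (d.embDomain Fin.valEmbedding) F := fun d => by
    rw [restrictVars, MvPowerSeries.coeff_killCompl]
  have hdeg : ∀ d : Fin N →₀ ℕ, N < d.degree →
      MvPowerSeries.coeff d (restrictVars K N F) = 0 := fun d hd => by
    rw [hcoeff, Finsupp.embDomain_eq_mapDomain]
    exact hN _ (by rwa [Finsupp.degree_mapDomain])
  let f : MvPolynomial (Fin N) K := ∑ d ∈ (Finsupp.finite_of_degree_le (σ := Fin N) N).toFinset,
    MvPolynomial.monomial d (MvPowerSeries.coeff d (restrictVars K N F))
  have hf : ∀ d, f.coeff d = MvPowerSeries.coeff d (restrictVars K N F) := by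
    intro d
    simp only [f, MvPolynomial.coeff_sum, MvPolynomial.coeff_monomial]
    rw [Finset.sum_ite_eq']
    split_ifs with h
    · rfl
    · refine (hdeg d ?_).symm
      simpa using h
  have hsymm : f.IsSymmetric := by
    intro π
    ext d
    obtain ⟨e, rfl⟩ : ∃ e : Fin N →₀ ℕ, d = e.mapDomain π :=
      ⟨d.mapDomain π.symm, by rw [← Finsupp.mapDomain_comp]; simp⟩
    rw [MvPolynomial.coeff_rename_mapDomain _ π.injective, hf, hf, hcoeff, hcoeff]
    let ρ : Equiv.Perm ℕ := π.viaFintypeEmbedding Fin.valEmbedding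
    rw [← (mem_symSeries_iff F).1 hF ρ]
    congr 2
    simp only [Finsupp.embDomain_eq_mapDomain, ← Finsupp.mapDomain_comp]
    congr 1
    ext i
    simp only [Function.comp, ρ]
    rw [Equiv.Perm.viaFintypeEmbedding_apply_image]
  obtain ⟨P, hP, hw⟩ := exists_finPowerSumHom_eq K N f hsymm
    fun d hd => by rw [hf, hdeg d hd]
  refine ⟨MvPolynomial.rename (succPNatFin N) P, Subtype.ext (sub_eq_zero.1 ?_)⟩
  refine eq_zero_of_restrictVars_eq_zero K N _ (sub_mem (powerSumHom K _).2.1 hF) ?_ ?_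
  · intro d hd
    rw [map_sub, hN d hd, sub_zero]
    conv_lhs => rw [P.as_sum]
    rw [map_sum, map_sum, AddSubmonoidClass.coe_finsetSum, map_sum]
    exact Finset.sum_eq_zero fun m hm =>
      coeff_powerSumHom_monomial_eq_zero K N m _ d (lt_of_le_of_lt (hw m hm) hd)
  · rw [map_sub, restrictVars_powerSumHom, hP, sub_eq_zero]
    ext d
    rw [MvPolynomial.coeff_coe, hf]

/-- The isomorphism between polynomials in the indeterminates `p₁, p₂, …` and symmetric
functions. -/
def powerSumEquiv [CharZero K] : MvPolynomial ℕ+ K ≃ₐ[K] SymFun K :=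
  AlgEquiv.ofBijective (powerSumHom K) ⟨powerSumHom_injective K, powerSumHom_surjective K⟩

end FundamentalTheorem

section Operations

variable {K : Type*} [Field K] [CharZero K]

/-! ### The Hall scalar product

A finitely supported `m : ℕ+ →₀ ℕ` stands for the partition `(1^{m₁} 2^{m₂} ⋯)`. -/

/-- The integer `∑ₖ k mₖ` of which `(1^{m₁} 2^{m₂} ⋯)` is a partition. -/
def partitionSize (m : ℕ+ →₀ ℕ) : ℕ := m.sum fun k e => (k : ℕ) * e

/-- `z_λ = ∏ₖ k^{mₖ} mₖ!` for `λ = (1^{m₁} 2^{m₂} ⋯)`. -/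
def zOf (m : ℕ+ →₀ ℕ) : ℕ := m.prod fun k e => (k : ℕ) ^ e * e.factorial

/-- The coefficient of `p_λ = ∏ₖ pₖ^{mₖ}` in the expansion of a symmetric series on power sums. -/
def powerSumCoeff (F : SymSeries K) (m : ℕ+ →₀ ℕ) : K :=
  MvPolynomial.coeff m ((powerSumEquiv K).symm (SymSeries.homogComp (partitionSize m) F))

/-- The Hall scalar product, for which `⟨p_λ, p_μ⟩ = z_λ δ_{λμ}`. The sum has finitely many nonzero
terms as soon as one of the two arguments is a symmetric function, see
`finite_support_scalarProduct_left` and `finite_support_scalarProduct_right`. -/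
def scalarProduct (F G : SymSeries K) : K :=
  ∑ᶠ m : ℕ+ →₀ ℕ, (zOf m : K) * powerSumCoeff F m * powerSumCoeff G m

theorem finite_partitionSize_le (N : ℕ) : {m : ℕ+ →₀ ℕ | partitionSize m ≤ N}.Finite := by
  classical
  let I : Finset ℕ+ := Finset.univ.image (succPNatFin N)
  refine (Set.Finite.subset (I.finsupp fun _ => Finset.range (N + 1)).finite_toSet ?_)
  intro m hm
  have hm : (∑ k ∈ m.support, (k : ℕ) * m k) ≤ N := hm
  have h1 : ∀ k ∈ m.support, (k : ℕ) * m k ≤ N := fun k hk =>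
    (Finset.single_le_sum (f := fun k : ℕ+ => (k : ℕ) * m k) (fun _ _ => Nat.zero_le _) hk).trans hm
  rw [Finset.mem_coe, Finset.mem_finsupp_iff]
  refine ⟨fun k hk => ?_, fun k _ => ?_⟩
  · have h2 : 1 ≤ m k := Nat.one_le_iff_ne_zero.2 (Finsupp.mem_support_iff.1 hk)
    have h3 : (k : ℕ) ≤ N := le_trans (Nat.le_mul_of_pos_right _ h2) (h1 k hk)
    have h4 := k.pos
    exact Finset.mem_image.2 ⟨⟨k - 1, by omega⟩, Finset.mem_univ _,
      PNat.eq (Nat.sub_add_cancel k.pos)⟩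
  · by_cases hk : k ∈ m.support
    · exact Finset.mem_range.2
        (Nat.lt_succ_of_le (le_trans (Nat.le_mul_of_pos_left _ k.pos) (h1 k hk)))
    · simp [Finsupp.notMem_support_iff.1 hk]

theorem finite_support_powerSumCoeff (f : SymFun K) :
    (Function.support (powerSumCoeff (SymFun.toSeries f))).Finite := by
  obtain ⟨F, hF, N, hN⟩ := f
  refine (finite_partitionSize_le N).subset fun m hm => ?_
  by_contra h
  have h : N < partitionSize m := not_le.1 h
  refine hm ?_
  have h0 : SymSeries.homogComp (partitionSize m) (SymFun.toSeries ⟨F, hF, N, hN⟩) = 0 := by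
    refine Subtype.ext ?_
    ext d
    change (if d.degree = partitionSize m then MvPowerSeries.coeff d F else 0) = 0
    split_ifs with hd
    · exact hN d (by rwa [hd])
    · rfl
  rw [powerSumCoeff, h0, map_zero, MvPolynomial.coeff_zero]

theorem finite_support_scalarProduct_left (f : SymFun K) (G : SymSeries K) :
    (Function.support fun m => (zOf m : K) * powerSumCoeff (SymFun.toSeries f) m *
      powerSumCoeff G m).Finite := by
  refine (finite_support_powerSumCoeff f).subset fun m hm h => hm ?_
  simp only [h, mul_zero, zero_mul]

theorem finite_support_scalarProduct_right (F : SymSeries K) (g : SymFun K) :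
    (Function.support fun m => (zOf m : K) * powerSumCoeff F m *
      powerSumCoeff (SymFun.toSeries g) m).Finite := by
  refine (finite_support_powerSumCoeff g).subset fun m hm h => hm ?_
  simp only [h, mul_zero]

/-! ### Outer plethysm -/

/-- The outer plethysm `f[G]`: if `f = P(p₁, p₂, …)`, then `f[G] = P(p₁[G], p₂[G], …)`, where
`pₖ[G] = G(x₀ᵏ, x₁ᵏ, …)`. -/
def outerPlethysm (f : SymFun K) (G : SymSeries K) : SymSeries K :=
  MvPolynomial.aeval (fun k : ℕ+ => SymSeries.powerSubst k G) ((powerSumEquiv K).symm f)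

/-! ### The Frobenius characteristic and inner plethysm -/

/-- `p_μ`, where `μ` is the cycle type of the permutation `τ` (fixed points included). -/
def cyclePowerSum (K : Type*) [Field K] {n : ℕ} (τ : Equiv.Perm (Fin n)) : SymFun K :=
  (τ.partition.parts.map (SymFun.psum K)).prod

/-- The Frobenius characteristic `(1 / n!) ∑_τ ξ(τ) p_{type(τ)}` of a class function `ξ` of the
symmetric group on `n` letters. -/
def frobeniusChar (n : ℕ) (ξ : Equiv.Perm (Fin n) → K) : SymFun K :=
  (n.factorial : K)⁻¹ • ∑ τ : Equiv.Perm (Fin n), ξ τ • cyclePowerSum K τ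

/-- The class function `τ ↦ ⟨F, p_{type(τ)}⟩` of the symmetric group on `n` letters, whose Frobenius
characteristic is the homogeneous component of degree `n` of `F`. -/
def classFunctionOf (n : ℕ) (F : SymSeries K) : Equiv.Perm (Fin n) → K :=
  fun τ => scalarProduct F (SymFun.toSeries (cyclePowerSum K τ))

/-- The Adams operation `ψᵏ` on class functions, `ψᵏ(ξ)(τ) = ξ(τᵏ)`. -/
def adams {n : ℕ} (k : ℕ+) (ξ : Equiv.Perm (Fin n) → K) : Equiv.Perm (Fin n) → K :=
  fun τ => ξ (τ ^ (k : ℕ))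

/-- The operation attached to a symmetric function `f = P(p₁, p₂, …)` by the `λ`-ring structure of
the ring of class functions: `ξ ↦ P(ψ¹(ξ), ψ²(ξ), …)`, with pointwise products. On the character of
a representation, the complete function `hₖ` gives its `k`-th symmetric power and the elementary
function `eₖ` its `k`-th exterior power. -/
def lambdaOperation (f : SymFun K) {n : ℕ} (ξ : Equiv.Perm (Fin n) → K) :
    Equiv.Perm (Fin n) → K :=
  MvPolynomial.aeval (fun k : ℕ+ => adams k ξ) ((powerSumEquiv K).symm f)

/-- The inner plethysm `f̂[F]` of a symmetric series `F`, taken degree by degree: its homogeneous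
component of degree `n` is the Frobenius characteristic of the class function obtained by applying
the operation of `f` to the class function with characteristic the component of degree `n`
of `F`. -/
def innerPlethysm (f : SymFun K) (F : SymSeries K) : SymSeries K :=
  SymSeries.ofComponents fun n => frobeniusChar n (lambdaOperation f (classFunctionOf n F))

end Operations

end

noncomputable section

/-! By bilinearity the theorem reduces to $f=p_\lambda$ and $g=p_\mu$, and then both sides equal
$\prod_i\mathrm{fix}_\mu(\lambda_i)$, where $\mathrm{fix}_\mu(k)=\sum_{\mu_j\mid k}\mu_j$ is the
number of fixed points of $\tau^k$ for a permutation $\tau$ of cycle type $\mu$ (`fixedCount`).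

Inner side: pairing with $p_\mu$ evaluates a class function at a permutation of type $\mu$. The
series $\sigma_1h_1$ gives the class function "number of fixed points", $\psi^k$ turns it into the
number of fixed points of $\tau^k$, and products are pointwise. Hence $\hat f[\sigma_1h_1]$ with
$f=P(p_1,p_2,\dots)$ pairs with $p_\mu$ to $P(\mathrm{fix}_\mu(1),\mathrm{fix}_\mu(2),\dots)$; this
is `zOf_mul_powerSumCoeff_innerPlethysm`. It relies on `cycleCounts_pow_one` and on the class sizes
$n!/z_\mu$ (`card_cycleCounts_eq_mul_zOf`).

Outer side: Newton's identities give $\sigma_1=\exp(\sum_k p_k/k)$, so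
$p_j[\sigma_1]=\exp(\sum_{j\mid k}j\,p_k/k)$ and
$p_\mu[\sigma_1]=\exp(\sum_k\mathrm{fix}_\mu(k)\,p_k/k)$. Pairing $\exp(\sum_k c_kp_k)$ with
$p_\lambda$ gives $\prod_i\lambda_ic_{\lambda_i}$, since $z_\lambda$ cancels the factorials; this is
`zOf_mul_powerSumCoeff_outerPlethysm_sigmaOne`.

To compute with infinite series, the expansion on power sums is made into an algebra homomorphism
`powerSumSeries` to power series in $p_1,p_2,\dots$. -/

/-- Induction on finitely supported functions with natural values, adding one unit at a time. -/
theorem Finsupp.induction_add_single_one {σ : Type*} {p : (σ →₀ ℕ) → Prop} (m : σ →₀ ℕ)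
    (zero : p 0) (add : ∀ m k, p m → p (m + Finsupp.single k 1)) : p m := by
  classical
  induction h : m.degree generalizing m with
  | zero => rwa [(Finsupp.degree_eq_zero_iff m).1 h]
  | succ N ih =>
    obtain ⟨k, hk⟩ : ∃ k, m k ≠ 0 := by
      by_contra! h'
      obtain rfl : m = 0 := Finsupp.ext h'
      simp at h
    obtain ⟨m', rfl⟩ : ∃ m', m = m' + Finsupp.single k 1 :=
      ⟨m - Finsupp.single k 1, (tsub_add_cancel_of_le (by simpa using by omega)).symm⟩
    exact add _ _ (ih _ (by simpa using h))

/-! ### Expansion of symmetric series on power sums -/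

section PowerSumExpansion

variable {K : Type*} [Field K]

theorem partitionSize_add (m n : ℕ+ →₀ ℕ) :
    partitionSize (m + n) = partitionSize m + partitionSize n := by
  classical
  exact Finsupp.sum_add_index' (by simp) (by intros; ring)

theorem partitionSize_single (k : ℕ+) (e : ℕ) :
    partitionSize (Finsupp.single k e) = k * e :=
  Finsupp.sum_single_index (by simp)

theorem coeff_powerSumHom_monomial_of_ne (m : ℕ+ →₀ ℕ) (c : K) (d : ℕ →₀ ℕ)
    (hd : d.degree ≠ partitionSize m) :
    MvPowerSeries.coeff d (powerSumHom K (MvPolynomial.monomial m c) : MvPowerSeries ℕ K) = 0 := by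
  classical
  induction m using Finsupp.induction_add_single_one generalizing d with
  | zero =>
    rw [← MvPolynomial.C_apply, ← MvPolynomial.algebraMap_eq,
      AlgHom.commutes, Subalgebra.coe_algebraMap, MvPowerSeries.algebraMap_apply,
      MvPowerSeries.coeff_C, if_neg]
    rintro rfl
    simp [partitionSize] at hd
  | add m k ih =>
    rw [partitionSize_add, partitionSize_single, mul_one] at hd
    rw [← mul_one c, ← MvPolynomial.monomial_mul, map_mul, MulMemClass.coe_mul,
      MvPowerSeries.coeff_mul]
    refine Finset.sum_eq_zero fun ab hab => ?_
    have hab := Finset.HasAntidiagonal.mem_antidiagonal.1 hab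
    have h : ab.1.degree + ab.2.degree = d.degree := by rw [← hab, map_add]
    by_cases h1 : ab.1.degree = partitionSize m
    · refine mul_eq_zero_of_right _ ?_
      change MvPowerSeries.coeff ab.2 (powerSumHom K (MvPolynomial.X k) : MvPowerSeries ℕ K) = 0
      rw [powerSumHom, MvPolynomial.aeval_X]
      refine if_neg ?_
      rintro ⟨i, hi⟩
      rw [hi] at h
      simp at h
      omega
    · rw [ih _ h1, zero_mul]

/-- Giving the variable $p_k$ weight $k$ makes the substitution graded. Consequently the passage to
a homogeneous component inside `powerSumCoeff` is harmless for elements of $Sym$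
(`powerSumCoeff_toSeries`). -/
theorem homogComp_powerSumHom (n : ℕ) (P : MvPolynomial ℕ+ K) :
    SymSeries.homogComp n (SymFun.toSeries (powerSumHom K P)) =
      powerSumHom K (MvPolynomial.weightedHomogeneousComponent (fun k : ℕ+ => (k : ℕ)) n P) := by
  classical
  refine Subtype.ext ?_
  ext d
  change (if d.degree = n then
    MvPowerSeries.coeff d (powerSumHom K P : MvPowerSeries ℕ K) else 0) = _
  induction P using MvPolynomial.induction_on' with
  | monomial m c =>
    have hw : Finsupp.weight (fun k : ℕ+ => (k : ℕ)) m = partitionSize m := by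
      simp [Finsupp.weight_apply, partitionSize, mul_comm]
    by_cases h : partitionSize m = n
    · rw [(MvPolynomial.isWeightedHomogeneous_monomial _ m c
        (hw.trans h)).weightedHomogeneousComponent_same]
      split_ifs with hd
      · rfl
      · exact (coeff_powerSumHom_monomial_of_ne m c d (h ▸ hd)).symm
    · rw [(MvPolynomial.isWeightedHomogeneous_monomial _ m c
        hw).weightedHomogeneousComponent_ne _ (Ne.symm h)]
      simp only [map_zero, ZeroMemClass.coe_zero]
      split_ifs with hd
      · exact coeff_powerSumHom_monomial_of_ne m c d (by rw [hd]; exact Ne.symm h)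
      · rfl
  | add p q hp hq =>
    simp only [map_add, AddMemClass.coe_add, ← hp, ← hq]
    split_ifs <;> simp

namespace SymSeries

/-- The part of degree at most `N`. -/
def truncLE (N : ℕ) (F : SymSeries K) : SymFun K :=
  ⟨ofCoeff fun d => if d.degree ≤ N then MvPowerSeries.coeff d (F : MvPowerSeries ℕ K) else 0, by
    refine ⟨?_, N, fun d hd => if_neg hd.not_ge⟩
    rw [mem_symSeries_iff]
    intro π d
    rw [coeff_ofCoeff, coeff_ofCoeff, Finsupp.degree_mapDomain, (mem_symSeries_iff _).1 F.2]⟩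

theorem coeff_truncLE {N : ℕ} {d : ℕ →₀ ℕ} (hd : d.degree ≤ N) (F : SymSeries K) :
    MvPowerSeries.coeff d (truncLE N F : MvPowerSeries ℕ K) =
      MvPowerSeries.coeff d (F : MvPowerSeries ℕ K) :=
  if_pos hd

end SymSeries

/-- The substitution $x_i\mapsto x_i^j$ is a ring homomorphism and sends $p_k$ to $p_{jk}$. -/
theorem powerSubst_powerSumHom (j : ℕ+) (P : MvPolynomial ℕ+ K) :
    SymSeries.powerSubst j (SymFun.toSeries (powerSumHom K P)) =
      SymFun.toSeries (powerSumHom K (MvPolynomial.rename (j * ·) P)) := by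
  classical
  refine Subtype.ext ?_
  change MvPowerSeries.expand (j : ℕ) j.ne_zero (powerSumHom K P : MvPowerSeries ℕ K) =
    (powerSumHom K (MvPolynomial.rename (j * ·) P) : MvPowerSeries ℕ K)
  induction P using MvPolynomial.induction_on with
  | C a =>
    rw [MvPolynomial.rename_C, ← MvPolynomial.algebraMap_eq, AlgHom.commutes,
      Subalgebra.coe_algebraMap, AlgHom.commutes]
  | add p q hp hq => simp only [map_add, AddMemClass.coe_add, hp, hq]
  | mul_X p k hp =>
    simp only [map_mul, MulMemClass.coe_mul, hp, MvPolynomial.rename_X]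
    congr 1
    simp only [powerSumHom, MvPolynomial.aeval_X]
    ext d
    change _ = if ∃ i, d = Finsupp.single i ((j * k : ℕ+) : ℕ) then (1 : K) else 0
    by_cases h : ∃ e : ℕ →₀ ℕ, d = (j : ℕ) • e
    · obtain ⟨e, rfl⟩ := h
      rw [MvPowerSeries.coeff_expand_smul]
      change (if ∃ i, e = Finsupp.single i (k : ℕ) then (1 : K) else 0) = _
      refine if_congr (exists_congr fun i => ?_) rfl rfl
      rw [PNat.mul_coe, ← smul_eq_mul, ← Finsupp.smul_single]
      exact (smul_right_injective _ j.ne_zero).eq_iff.symm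
    · rw [if_neg]
      · obtain ⟨i, hi⟩ : ∃ i, ¬ (j : ℕ) ∣ d i := by
          by_contra! h'
          exact h ⟨d.mapRange (· / (j : ℕ)) (Nat.zero_div _), by
            ext i; simp [Nat.mul_div_cancel' (h' i)]⟩
        exact MvPowerSeries.coeff_expand_of_not_dvd (i := i) _ _ _ hi
      · rintro ⟨i, rfl⟩
        exact h ⟨Finsupp.single i (k : ℕ), by simp⟩

variable [CharZero K]

theorem powerSumEquiv_symm_powerSumHom (P : MvPolynomial ℕ+ K) :
    (powerSumEquiv K).symm (powerSumHom K P) = P :=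
  (powerSumEquiv K).symm_apply_apply P

theorem powerSumHom_powerSumEquiv_symm (f : SymFun K) :
    powerSumHom K ((powerSumEquiv K).symm f) = f :=
  (powerSumEquiv K).apply_symm_apply f

theorem powerSumCoeff_toSeries (f : SymFun K) (m : ℕ+ →₀ ℕ) :
    powerSumCoeff (SymFun.toSeries f) m = MvPolynomial.coeff m ((powerSumEquiv K).symm f) := by
  classical
  obtain ⟨P, rfl⟩ := powerSumHom_surjective K f
  rw [powerSumCoeff, homogComp_powerSumHom, powerSumEquiv_symm_powerSumHom,
    powerSumEquiv_symm_powerSumHom, MvPolynomial.coeff_weightedHomogeneousComponent, if_pos]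
  simp [Finsupp.weight_apply, partitionSize, mul_comm]

/-- Only the component of degree $|m|$ enters the coefficient at $m$. Thus a series may be replaced
by a truncation in $Sym$, where the isomorphism with polynomials is available. -/
theorem powerSumCoeff_congr {F G : SymSeries K} {m : ℕ+ →₀ ℕ}
    (h : ∀ d : ℕ →₀ ℕ, d.degree = partitionSize m →
      MvPowerSeries.coeff d (F : MvPowerSeries ℕ K) =
        MvPowerSeries.coeff d (G : MvPowerSeries ℕ K)) :
    powerSumCoeff F m = powerSumCoeff G m := by
  have : SymSeries.homogComp (partitionSize m) F = SymSeries.homogComp (partitionSize m) G := by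
    refine Subtype.ext (funext fun d => ?_)
    change (if _ then _ else _) = (if _ then _ else _)
    split_ifs with hd
    · exact h d hd
    · rfl
  rw [powerSumCoeff, this, powerSumCoeff]

namespace SymSeries

theorem powerSumCoeff_truncLE {N : ℕ} {m : ℕ+ →₀ ℕ} (hm : partitionSize m ≤ N)
    (F : SymSeries K) :
    powerSumCoeff F m = powerSumCoeff (SymFun.toSeries (truncLE N F)) m :=
  powerSumCoeff_congr fun _ hd => (coeff_truncLE (hd.trans_le hm) F).symm

end SymSeries

/-- In degree $|m|$ the product depends only on the parts of degree at most $|m|$ of the factors.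
After truncation it is a product of polynomials in the $p_k$. -/
theorem powerSumCoeff_mul (F G : SymSeries K) (m : ℕ+ →₀ ℕ) :
    powerSumCoeff (F * G) m =
      ∑ uv ∈ Finset.HasAntidiagonal.antidiagonal m, powerSumCoeff F uv.1 * powerSumCoeff G uv.2 := by
  classical
  set N := partitionSize m with hN
  have h : powerSumCoeff (F * G) m =
      powerSumCoeff (SymFun.toSeries (SymSeries.truncLE N F * SymSeries.truncLE N G)) m := by
    refine powerSumCoeff_congr fun d hd => ?_
    change MvPowerSeries.coeff d ((F : MvPowerSeries ℕ K) * (G : MvPowerSeries ℕ K)) =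
      MvPowerSeries.coeff d (((SymSeries.truncLE N F : SymFun K) : MvPowerSeries ℕ K) *
        ((SymSeries.truncLE N G : SymFun K) : MvPowerSeries ℕ K))
    rw [MvPowerSeries.coeff_mul, MvPowerSeries.coeff_mul]
    refine Finset.sum_congr rfl fun ab hab => ?_
    have hab := Finset.HasAntidiagonal.mem_antidiagonal.1 hab
    have h : ab.1.degree + ab.2.degree = d.degree := by rw [← hab, map_add]
    rw [SymSeries.coeff_truncLE (by omega), SymSeries.coeff_truncLE (by omega)]
  rw [h, powerSumCoeff_toSeries, map_mul, MvPolynomial.coeff_mul]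
  refine Finset.sum_congr rfl fun uv huv => ?_
  have huv := Finset.HasAntidiagonal.mem_antidiagonal.1 huv
  have h : partitionSize uv.1 + partitionSize uv.2 = N := by rw [hN, ← huv, partitionSize_add]
  rw [SymSeries.powerSumCoeff_truncLE (N := N) (by omega) F,
    SymSeries.powerSumCoeff_truncLE (N := N) (by omega) G,
    powerSumCoeff_toSeries, powerSumCoeff_toSeries]

theorem powerSumCoeff_add (F G : SymSeries K) (m : ℕ+ →₀ ℕ) :
    powerSumCoeff (F + G) m = powerSumCoeff F m + powerSumCoeff G m := by
  have h : powerSumCoeff (F + G) m = powerSumCoeff (SymFun.toSeries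
      (SymSeries.truncLE (partitionSize m) F + SymSeries.truncLE (partitionSize m) G)) m := by
    refine powerSumCoeff_congr fun d hd => ?_
    change MvPowerSeries.coeff d ((F : MvPowerSeries ℕ K) + (G : MvPowerSeries ℕ K)) =
      MvPowerSeries.coeff d ((SymSeries.truncLE _ F : MvPowerSeries ℕ K) +
        ((SymSeries.truncLE _ G : SymFun K) : MvPowerSeries ℕ K))
    rw [map_add, map_add, SymSeries.coeff_truncLE hd.le, SymSeries.coeff_truncLE hd.le]
  rw [h, SymSeries.powerSumCoeff_truncLE le_rfl F, SymSeries.powerSumCoeff_truncLE le_rfl G]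
  rw [powerSumCoeff_toSeries, powerSumCoeff_toSeries, powerSumCoeff_toSeries, map_add,
    MvPolynomial.coeff_add]

/-- The formal power series with coefficients `powerSumCoeff F`. -/
def powerSumSeriesFun (F : SymSeries K) : MvPowerSeries ℕ+ K := fun m => powerSumCoeff F m

theorem coeff_powerSumSeriesFun (F : SymSeries K) (m : ℕ+ →₀ ℕ) :
    MvPowerSeries.coeff m (powerSumSeriesFun F) = powerSumCoeff F m := rfl

/-- The expansion of a symmetric series as a formal power series in the power sums. -/
def powerSumSeries (K : Type*) [Field K] [CharZero K] : SymSeries K →ₐ[K] MvPowerSeries ℕ+ K where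
  toFun F := powerSumSeriesFun F
  map_zero' := by
    ext m
    rw [coeff_powerSumSeriesFun, map_zero, ← map_zero SymFun.toSeries, powerSumCoeff_toSeries,
      map_zero, MvPolynomial.coeff_zero]
  map_one' := by
    classical
    ext m
    rw [coeff_powerSumSeriesFun, ← map_one SymFun.toSeries, powerSumCoeff_toSeries,
      map_one, MvPolynomial.coeff_one, MvPowerSeries.coeff_one]
    simp only [eq_comm]
  map_add' F G := by
    ext m
    simp only [map_add, coeff_powerSumSeriesFun, powerSumCoeff_add]
  map_mul' F G := by
    classical
    ext m
    rw [MvPowerSeries.coeff_mul]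
    simp only [coeff_powerSumSeriesFun, powerSumCoeff_mul]
  commutes' r := by
    classical
    ext m
    rw [coeff_powerSumSeriesFun, ← AlgHom.commutes SymFun.toSeries, powerSumCoeff_toSeries,
      AlgEquiv.commutes, MvPolynomial.algebraMap_eq, MvPolynomial.coeff_C, MvPowerSeries.algebraMap_apply,
      MvPowerSeries.coeff_C]
    simp only [eq_comm, Algebra.algebraMap_self, RingHom.id_apply]

theorem coeff_powerSumSeries (F : SymSeries K) (m : ℕ+ →₀ ℕ) :
    MvPowerSeries.coeff m (powerSumSeries K F) = powerSumCoeff F m := rfl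

theorem powerSumCoeff_powerSubst (j : ℕ+) (F : SymSeries K) (m : ℕ+ →₀ ℕ) :
    powerSumCoeff (SymSeries.powerSubst j F) m =
      MvPolynomial.coeff m (MvPolynomial.rename (j * ·)
        ((powerSumEquiv K).symm (SymSeries.truncLE (partitionSize m) F))) := by
  rw [← powerSumEquiv_symm_powerSumHom (MvPolynomial.rename _ _), ← powerSumCoeff_toSeries,
    ← powerSubst_powerSumHom, powerSumHom_powerSumEquiv_symm]
  refine powerSumCoeff_congr fun d hd => ?_
  change MvPowerSeries.coeff d (MvPowerSeries.expand (j : ℕ) j.ne_zero (F : MvPowerSeries ℕ K)) =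
    MvPowerSeries.coeff d (MvPowerSeries.expand (j : ℕ) j.ne_zero
      (SymSeries.truncLE (partitionSize m) F : MvPowerSeries ℕ K))
  by_cases h : ∃ i, ¬ (j : ℕ) ∣ d i
  · obtain ⟨i, hi⟩ := h
    rw [MvPowerSeries.coeff_expand_of_not_dvd _ _ _ hi,
      MvPowerSeries.coeff_expand_of_not_dvd _ _ _ hi]
  · push Not at h
    obtain ⟨e, rfl⟩ : ∃ e : ℕ →₀ ℕ, d = (j : ℕ) • e :=
      ⟨d.mapRange (· / (j : ℕ)) (Nat.zero_div _), by
        ext i; simp [Nat.mul_div_cancel' (h i)]⟩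
    rw [MvPowerSeries.coeff_expand_smul, MvPowerSeries.coeff_expand_smul,
      SymSeries.coeff_truncLE]
    -- The monomial of exponent $j\cdot e$ comes from the one of exponent $e$, whose degree is
    -- smaller by the factor $j$; truncating at $|m|$ is more than enough.
    rw [← hd, map_nsmul, smul_eq_mul]
    exact Nat.le_mul_of_pos_left _ j.pos

end PowerSumExpansion

end

/-! ### Exponentials of linear forms in the power sums -/

noncomputable section

/-- `∏ₖ cₖ^{mₖ} / mₖ!`, the coefficient of the monomial of exponent `m` in `exp (∑ₖ cₖ Xₖ)`. -/
def expCoeff {K : Type*} [Field K] (c : ℕ+ → K) (m : ℕ+ →₀ ℕ) : K :=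
  m.prod fun k e => c k ^ e / (e.factorial : K)

/-- The formal power series `exp (∑ₖ cₖ Xₖ)`. -/
def expSeries {K : Type*} [Field K] (c : ℕ+ → K) : MvPowerSeries ℕ+ K := expCoeff c

section ExpSeries

variable {K : Type*} [Field K]

theorem coeff_expSeries (c : ℕ+ → K) (m : ℕ+ →₀ ℕ) :
    MvPowerSeries.coeff m (expSeries c) = expCoeff c m := rfl

theorem expCoeff_zero_right (c : ℕ+ → K) : expCoeff c 0 = 1 := Finsupp.prod_zero_index

variable [CharZero K]

/-- Only the factor at $k$ changes, from $c^e/e!$ to $c^{e+1}/(e+1)!$. This is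
$\partial_k\exp=c_k\exp$ read on coefficients. -/
theorem expCoeff_add_single (c : ℕ+ → K) (m : ℕ+ →₀ ℕ) (k : ℕ+) :
    expCoeff c (m + Finsupp.single k 1) * (m k + 1) = c k * expCoeff c m := by
  have h0 : ∀ i : ℕ+, c i ^ 0 / ((0 : ℕ).factorial : K) = 1 := fun i => by simp
  have he : (m + Finsupp.single k 1).erase k = m.erase k := by
    ext i
    by_cases hi : i = k
    · simp [hi]
    · simp [Finsupp.erase_ne hi]
  rw [expCoeff, expCoeff, ← Finsupp.mul_prod_erase' m k _ h0,
    ← Finsupp.mul_prod_erase' (m + Finsupp.single k 1) k _ h0, he]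
  have h1 : (m k + 1 : K) ≠ 0 := by exact_mod_cast (m k).succ_ne_zero
  have h2 : ((m k).factorial : K) ≠ 0 := by exact_mod_cast (m k).factorial_ne_zero
  simp only [Finsupp.add_apply, Finsupp.single_eq_same, Nat.factorial_succ, Nat.cast_mul,
    Nat.cast_add, Nat.cast_one, pow_succ]
  field_simp

theorem pderiv_expSeries (c : ℕ+ → K) (k : ℕ+) :
    MvPowerSeries.pderiv K k (expSeries c) = c k • expSeries c := by
  ext m
  rw [MvPowerSeries.coeff_pderiv, coeff_expSeries, expCoeff_add_single, map_smul, smul_eq_mul,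
    coeff_expSeries]

/-- The equation for $\partial_k$ yields the coefficient at $m+\delta_k$ from the one at $m$, after
division by $m_k+1\ne0$. This uniqueness gives the functional equation of the exponential without
handling coefficients. -/
theorem eq_expSeries_of_pderiv {c : ℕ+ → K} {F : MvPowerSeries ℕ+ K}
    (h0 : MvPowerSeries.coeff 0 F = 1) (h : ∀ k, MvPowerSeries.pderiv K k F = c k • F) :
    F = expSeries c := by
  ext m
  rw [coeff_expSeries]
  induction m using Finsupp.induction_add_single_one with
  | zero => rw [h0, expCoeff_zero_right]
  | add m k ih =>
    have h1 : (m k + 1 : K) ≠ 0 := by exact_mod_cast (m k).succ_ne_zero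
    refine mul_right_cancel₀ h1 ?_
    rw [expCoeff_add_single, ← MvPowerSeries.coeff_pderiv, h k, map_smul, smul_eq_mul, ih]

theorem expSeries_zero : expSeries (0 : ℕ+ → K) = 1 := by
  classical
  refine (eq_expSeries_of_pderiv ?_ fun k => ?_).symm
  · simp
  · simp

theorem expSeries_add (c c' : ℕ+ → K) : expSeries (c + c') = expSeries c * expSeries c' := by
  refine (eq_expSeries_of_pderiv ?_ fun k => ?_).symm
  · rw [MvPowerSeries.coeff_zero_eq_constantCoeff_apply, map_mul,
      ← MvPowerSeries.coeff_zero_eq_constantCoeff_apply,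
      ← MvPowerSeries.coeff_zero_eq_constantCoeff_apply, coeff_expSeries, coeff_expSeries,
      expCoeff_zero_right, expCoeff_zero_right, mul_one]
  · rw [Derivation.leibniz, pderiv_expSeries, pderiv_expSeries, Pi.add_apply, add_smul]
    simp only [smul_eq_mul, mul_smul_comm]
    rw [mul_comm (expSeries c'), add_comm]

theorem expSeries_nsmul (n : ℕ) (c : ℕ+ → K) : expSeries (n • c) = expSeries c ^ n := by
  induction n with
  | zero => rw [zero_smul, pow_zero, expSeries_zero]
  | succ n ih => rw [add_smul, one_smul, expSeries_add, ih, pow_succ]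

theorem expSeries_sum {ι : Type*} (s : Finset ι) (c : ι → ℕ+ → K) :
    expSeries (∑ i ∈ s, c i) = ∏ i ∈ s, expSeries (c i) := by
  classical
  induction s using Finset.induction_on with
  | empty => rw [Finset.sum_empty, Finset.prod_empty, expSeries_zero]
  | insert i s hi ih => rw [Finset.sum_insert hi, Finset.prod_insert hi, expSeries_add, ih]

/-- The factorials in $z_m$ cancel those of the exponential. So pairing $\exp(\sum_k c_kp_k)$ with a
product of power sums is multiplicative: each $p_k$ contributes $k\,c_k$. -/
theorem zOf_mul_expCoeff (c : ℕ+ → K) (m : ℕ+ →₀ ℕ) :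
    (zOf m : K) * expCoeff c m = m.prod fun k e => ((k : ℕ) * c k) ^ e := by
  rw [zOf, expCoeff, Finsupp.prod, Nat.cast_prod, Finsupp.prod, ← Finset.prod_mul_distrib]
  refine Finset.prod_congr rfl fun k _ => ?_
  have h2 : ((m k).factorial : K) ≠ 0 := by exact_mod_cast (m k).factorial_ne_zero
  push_cast
  rw [mul_pow]
  field_simp

theorem zOf_mul_expCoeff_inv (m : ℕ+ →₀ ℕ) :
    (zOf m : K) * expCoeff (fun k => ((k : ℕ) : K)⁻¹) m = 1 := by
  rw [zOf_mul_expCoeff]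
  refine Finset.prod_eq_one fun k _ => ?_
  beta_reduce
  rw [mul_inv_cancel₀ (by exact_mod_cast k.ne_zero), one_pow]

end ExpSeries

/-! ### Newton's identities and the expansion of $\sigma_1$ and $p_j[\sigma_1]$ -/

section Newton

variable {K : Type*} [Field K]

theorem coeff_psum_mul (k : ℕ) (hk : k ≠ 0) (F : MvPowerSeries ℕ K) (d : ℕ →₀ ℕ) :
    MvPowerSeries.coeff d ((SymFun.psum K k : MvPowerSeries ℕ K) * F) =
      ∑ i ∈ d.support,
        if k ≤ d i then MvPowerSeries.coeff (d - Finsupp.single i k) F else 0 := by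
  classical
  -- The existential indicator becomes a sum of indicators over $i$: at most one is nonzero because
  -- $k\ne0$, and such an $i$ lies in the support of $d$ because `ab.1` is at most $d$.
  have h : ∀ ab ∈ Finset.HasAntidiagonal.antidiagonal d,
      MvPowerSeries.coeff ab.1 (SymFun.psum K k : MvPowerSeries ℕ K) * MvPowerSeries.coeff ab.2 F =
        ∑ i ∈ d.support, if ab.1 = Finsupp.single i k then MvPowerSeries.coeff ab.2 F else 0 := by
    intro ab hab
    have hab := Finset.HasAntidiagonal.mem_antidiagonal.1 hab
    change (if ∃ i, ab.1 = Finsupp.single i k then (1 : K) else 0) * _ = _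
    by_cases h : ∃ i, ab.1 = Finsupp.single i k
    · obtain ⟨i, hi⟩ := h
      rw [if_pos ⟨i, hi⟩, one_mul, Finset.sum_eq_single i, if_pos hi]
      · intro j _ hj
        rw [if_neg]
        rw [hi, Finsupp.single_left_inj hk]
        exact hj.symm
      · intro hi'
        rw [← hab, hi] at hi'
        simp [hk] at hi'
    · rw [if_neg h, zero_mul, Finset.sum_eq_zero fun i _ => if_neg fun hi => h ⟨i, hi⟩]
  rw [MvPowerSeries.coeff_mul, Finset.sum_congr rfl h, Finset.sum_comm]
  refine Finset.sum_congr rfl fun i _ => ?_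
  split_ifs with hi
  · have hle : Finsupp.single i k ≤ d := Finsupp.single_le_iff.2 hi
    rw [Finset.sum_eq_single (Finsupp.single i k, d - Finsupp.single i k), if_pos rfl]
    · intro ab hab hne
      have hab := Finset.HasAntidiagonal.mem_antidiagonal.1 hab
      refine if_neg fun h1 => hne (Prod.ext h1 ?_)
      rw [← hab, h1, add_tsub_cancel_left]
    · intro hn
      exact absurd (Finset.HasAntidiagonal.mem_antidiagonal.2 (add_tsub_cancel_of_le hle)) hn
  · refine Finset.sum_eq_zero fun ab hab => if_neg fun h1 => hi ?_
    have hab := Finset.HasAntidiagonal.mem_antidiagonal.1 hab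
    rw [← Finsupp.single_le_iff, ← h1, ← hab]
    exact le_self_add

theorem SymFun.hsymm_zero : SymFun.hsymm K 0 = 1 := by
  classical
  refine Subtype.ext ?_
  ext d
  change (if d.degree = 0 then (1 : K) else 0) = MvPowerSeries.coeff d 1
  rw [MvPowerSeries.coeff_one]
  exact if_congr (Finsupp.degree_eq_zero_iff d) rfl rfl

/-- For $x^d$ of degree $n$, the right-hand coefficient counts the pairs $(i,j)$ with $i<d_j$, and
there are $\sum_jd_j=n$ of them. In other degrees both sides vanish. -/
theorem nsmul_hsymm (n : ℕ) :
    n • SymFun.hsymm K n =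
      ∑ i ∈ Finset.range n, SymFun.psum K (i + 1) * SymFun.hsymm K (n - 1 - i) := by
  classical
  refine Subtype.ext ?_
  rw [AddSubmonoidClass.coe_finsetSum, AddSubmonoidClass.coe_nsmul]
  ext d
  rw [map_nsmul, map_sum]
  change n • (if d.degree = n then (1 : K) else 0) = _
  have h : ∀ i ∈ Finset.range n, MvPowerSeries.coeff d
      ((SymFun.psum K (i + 1) * SymFun.hsymm K (n - 1 - i) : SymFun K) : MvPowerSeries ℕ K) =
      ∑ j ∈ d.support, if i + 1 ≤ d j then (if d.degree = n then (1 : K) else 0) else 0 := by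
    intro i hi
    rw [MulMemClass.coe_mul, coeff_psum_mul _ i.succ_ne_zero]
    refine Finset.sum_congr rfl fun j _ => ?_
    refine ite_congr rfl (fun hj => ?_) fun _ => rfl
    change (if (d - Finsupp.single j (i + 1)).degree = n - 1 - i then (1 : K) else 0) = _
    have h1 : (d - Finsupp.single j (i + 1)).degree + (i + 1) = d.degree := by
      conv_rhs => rw [← tsub_add_cancel_of_le (Finsupp.single_le_iff.2 hj)]
      rw [map_add, Finsupp.degree_single]
    have h2 := Finset.mem_range.1 hi
    exact if_congr (by omega) rfl rfl
  rw [Finset.sum_congr rfl h, Finset.sum_comm]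
  by_cases hd : d.degree = n
  · simp only [if_pos hd]
    have h3 : ∀ j ∈ d.support,
        (∑ i ∈ Finset.range n, if i + 1 ≤ d j then (1 : K) else 0) = d j := by
      intro j _
      have h4 : d j ≤ n := hd ▸ Finsupp.le_degree j d
      rw [Finset.sum_boole]
      congr 1
      have : (Finset.range n).filter (fun i => i + 1 ≤ d j) = Finset.range (d j) := by
        ext i; simp; omega
      rw [this, Finset.card_range]
    rw [Finset.sum_congr rfl h3, ← Nat.cast_sum, ← Finsupp.degree_apply, hd, nsmul_eq_mul, mul_one]
  · simp [hd]

variable [CharZero K]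

/-- This is $h_n=\sum_{\lambda\vdash n}p_\lambda/z_\lambda$. By Newton and induction, the
coefficient of $p_m$ in $p_{i+1}h_{n-1-i}$ is that of $h$ at $m$ with one part $i+1$ removed, which
equals $(i+1)m_{i+1}$ times the claimed value. Summing over $i$ gives the factor $|m|=n$, which is
then cancelled. -/
theorem coeff_powerSumEquiv_symm_hsymm (m : ℕ+ →₀ ℕ) :
    MvPolynomial.coeff m ((powerSumEquiv K).symm (SymFun.hsymm K (partitionSize m))) =
      expCoeff (fun k => ((k : ℕ) : K)⁻¹) m := by
  classical
  induction h : partitionSize m using Nat.strong_induction_on generalizing m with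
  | _ n ih =>
    subst h
    rcases Nat.eq_zero_or_pos (partitionSize m) with h0 | hpos
    · obtain rfl : m = 0 := by
        ext k
        by_contra hk
        have : (k : ℕ) * m k = 0 :=
          Finset.sum_eq_zero_iff.1 h0 k (Finsupp.mem_support_iff.2 hk)
        exact (mul_ne_zero k.ne_zero hk) this
      rw [h0, SymFun.hsymm_zero, map_one, expCoeff_zero_right]
      simp
    · have hn : ((partitionSize m : ℕ) : K) ≠ 0 := by exact_mod_cast hpos.ne'
      refine mul_left_cancel₀ hn ?_
      rw [← nsmul_eq_mul, ← MvPolynomial.coeff_smul, ← map_nsmul, nsmul_hsymm, map_sum,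
        MvPolynomial.coeff_sum]
      set N := partitionSize m with hN
      have h1 : ∀ i ∈ Finset.range N, MvPolynomial.coeff m ((powerSumEquiv K).symm
          (SymFun.psum K (i + 1) * SymFun.hsymm K (N - 1 - i))) =
          ((i + 1 : ℕ) : K) * m i.succPNat * expCoeff (fun k => ((k : ℕ) : K)⁻¹) m := by
        intro i hi
        have hX : (powerSumEquiv K).symm (SymFun.psum K (i + 1)) =
            MvPolynomial.X i.succPNat := by
          rw [← powerSumEquiv_symm_powerSumHom (MvPolynomial.X _), powerSumHom, MvPolynomial.aeval_X,
            Nat.succPNat_coe]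
        rw [map_mul, hX, MvPolynomial.coeff_X_mul']
        split_ifs with hm
        · obtain ⟨m', hm'⟩ : ∃ m', m = m' + Finsupp.single i.succPNat 1 :=
            ⟨m - Finsupp.single i.succPNat 1, (tsub_add_cancel_of_le
              (by simpa [Nat.one_le_iff_ne_zero] using hm)).symm⟩
          have hs : partitionSize m' + (i + 1) = N := by
            rw [hN, hm', partitionSize_add, partitionSize_single, mul_one, Nat.succPNat_coe]
          have hi' : N - 1 - i = partitionSize m' := by omega
          have hrec := expCoeff_add_single (fun k : ℕ+ => ((k : ℕ) : K)⁻¹) m' i.succPNat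
          rw [← hm', Nat.succPNat_coe] at hrec
          have hmi : (m i.succPNat : K) = m' i.succPNat + 1 := by
            rw [hm']; simp
          have hi0 : ((i.succ : ℕ) : K) ≠ 0 := by exact_mod_cast i.succ_ne_zero
          have hsub : m - Finsupp.single i.succPNat 1 = m' := by rw [hm', add_tsub_cancel_right]
          rw [hsub, hi', ih _ (by omega) m' rfl, hmi, mul_assoc, mul_comm (_ + 1 : K), hrec,
            ← mul_assoc, mul_inv_cancel₀ hi0, one_mul]
        · rw [Finsupp.notMem_support_iff.1 hm]
          simp
      rw [Finset.sum_congr rfl h1, ← Finset.sum_mul]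
      congr 1
      have h2 : N = ∑ i ∈ Finset.range N, (i + 1) * m i.succPNat := by
        rw [hN]
        conv_lhs => rw [partitionSize, Finsupp.sum]
        rw [← hN]
        -- Reindexing by $k=i+1$; the indices $i<N$ that are not of the form $k-1$ with $m_k\ne0$
        -- carry zero terms.
        refine Finset.sum_bij_ne_zero (fun k _ _ => k.natPred) ?_ ?_ ?_ ?_
        · intro k hk _
          have : (k : ℕ) * m k ≤ N :=
            Finset.single_le_sum (f := fun k : ℕ+ => (k : ℕ) * m k) (fun _ _ => Nat.zero_le _) hk
          have h3 : 0 < m k := Nat.pos_of_ne_zero (Finsupp.mem_support_iff.1 hk)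
          have h4 := Nat.le_mul_of_pos_right (k : ℕ) h3
          have h5 := k.natPred_add_one
          exact Finset.mem_range.2 (by omega)
        · intro k _ _ l _ _ h
          exact PNat.natPred_injective h
        · intro i _ hi
          exact ⟨i.succPNat, Finsupp.mem_support_iff.2 (right_ne_zero_of_mul hi), by simpa using hi,
            Nat.natPred_succPNat i⟩
        · intro k _ _
          simp
      conv_rhs => rw [h2]
      push_cast
      rfl

theorem powerSumCoeff_sigmaOne (m : ℕ+ →₀ ℕ) :
    powerSumCoeff (sigmaOne K) m = expCoeff (fun k => ((k : ℕ) : K)⁻¹) m := by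
  rw [← coeff_powerSumEquiv_symm_hsymm, ← powerSumCoeff_toSeries]
  refine powerSumCoeff_congr fun d hd => ?_
  rw [← hd]
  rfl

theorem coeff_truncLE_sigmaOne {m : ℕ+ →₀ ℕ} {N : ℕ} (h : partitionSize m ≤ N) :
    MvPolynomial.coeff m ((powerSumEquiv K).symm (SymSeries.truncLE N (sigmaOne K))) =
      expCoeff (fun k => ((k : ℕ) : K)⁻¹) m := by
  rw [← powerSumCoeff_toSeries, ← SymSeries.powerSumCoeff_truncLE h, powerSumCoeff_sigmaOne]

/-- Replacing $p_l$ by $p_{jl}$ in $\exp(\sum_lp_l/l)$ and writing $k=jl$ turns $1/l$ into $j/k$. A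
monomial with a part not divisible by $j$ has coefficient zero on both sides. -/
theorem powerSumSeries_powerSubst_sigmaOne (j : ℕ+) :
    powerSumSeries K (SymSeries.powerSubst j (sigmaOne K)) =
      expSeries fun k => if (j : ℕ) ∣ k then ((j : ℕ) : K) * ((k : ℕ) : K)⁻¹ else 0 := by
  classical
  have hinj : Function.Injective (j * · : ℕ+ → ℕ+) := fun a b h => mul_left_cancel h
  ext m
  rw [coeff_powerSumSeries, powerSumCoeff_powerSubst, coeff_expSeries]
  by_cases h : ∀ k ∈ m.support, (j : ℕ) ∣ k
  · obtain ⟨m', rfl⟩ : ∃ m' : ℕ+ →₀ ℕ, m'.mapDomain (j * ·) = m := by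
      refine ⟨m.comapDomain (j * ·) hinj.injOn, Finsupp.mapDomain_comapDomain _ hinj _ ?_⟩
      intro k hk
      obtain ⟨l, rfl⟩ := PNat.dvd_iff.2 (h k hk)
      exact ⟨l, rfl⟩
    rw [MvPolynomial.coeff_rename_mapDomain _ hinj, coeff_truncLE_sigmaOne, expCoeff, expCoeff,
      Finsupp.prod_mapDomain_index_inj hinj]
    · refine Finset.prod_congr rfl fun k _ => ?_
      have hj : ((j : ℕ) : K) ≠ 0 := by exact_mod_cast j.ne_zero
      beta_reduce
      rw [if_pos (PNat.dvd_iff.1 (dvd_mul_right j k)), PNat.mul_coe, Nat.cast_mul, mul_inv,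
        mul_inv_cancel_left₀ hj]
    · rw [partitionSize, partitionSize, Finsupp.sum_mapDomain_index_inj hinj]
      refine Finset.sum_le_sum fun k _ => ?_
      beta_reduce
      rw [PNat.mul_coe]
      exact Nat.mul_le_mul_right _ (Nat.le_mul_of_pos_left _ j.pos)
  · push Not at h
    obtain ⟨k, hk, hjk⟩ := h
    rw [MvPolynomial.coeff_rename_eq_zero]
    · refine (Finset.prod_eq_zero hk ?_).symm
      beta_reduce
      rw [if_neg hjk, zero_pow (Finsupp.mem_support_iff.1 hk), zero_div]
    · rintro u rfl
      obtain ⟨l, -, rfl⟩ := Finset.mem_image.1 (Finsupp.mapDomain_support hk)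
      exact absurd (PNat.dvd_iff.1 (dvd_mul_right j l)) hjk

end Newton

end

noncomputable section

/-! ### Cycle types, fixed points of powers, and sizes of conjugacy classes -/

section CycleCounts

/-- The number of `x` with `τᵏ x = x`, for a permutation `τ` with `m j` cycles of length `j` for
every `j`. -/
def fixedCount (m : ℕ+ →₀ ℕ) (k : ℕ) : ℕ :=
  m.sum fun j e => if (j : ℕ) ∣ k then (j : ℕ) * e else 0

variable {n : ℕ}

/-- The function sending `k` to the number of cycles of length `k` of a permutation (fixed points
are cycles of length one). -/
def cycleCounts (τ : Equiv.Perm (Fin n)) : ℕ+ →₀ ℕ :=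
  (Multiset.toFinsupp τ.partition.parts).comapDomain PNat.val PNat.coe_injective.injOn

theorem cycleCounts_apply (τ : Equiv.Perm (Fin n)) (k : ℕ+) :
    cycleCounts τ k = τ.partition.parts.count (k : ℕ) := by
  rw [cycleCounts, Finsupp.comapDomain_apply, Multiset.toFinsupp_apply]

theorem toFinset_parts_partition (τ : Equiv.Perm (Fin n)) :
    τ.partition.parts.toFinset = (cycleCounts τ).support.map ⟨PNat.val, PNat.coe_injective⟩ := by
  ext a
  simp only [Multiset.mem_toFinset, Finset.mem_map, Finsupp.mem_support_iff, cycleCounts_apply,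
    Function.Embedding.coeFn_mk, Multiset.count_ne_zero]
  constructor
  · intro h
    exact ⟨⟨a, τ.partition.parts_pos h⟩, h, rfl⟩
  · rintro ⟨k, hk, rfl⟩
    exact hk

theorem cyclePowerSum_eq {K : Type*} [Field K] (τ : Equiv.Perm (Fin n)) :
    cyclePowerSum K τ = powerSumHom K (MvPolynomial.monomial (cycleCounts τ) 1) := by
  rw [powerSumHom, MvPolynomial.aeval_monomial, map_one, one_mul, cyclePowerSum,
    Finset.prod_multiset_map_count, toFinset_parts_partition, Finset.prod_map]
  refine Finset.prod_congr rfl fun k _ => ?_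
  rw [cycleCounts_apply]
  rfl

/-- On a cycle of length $a$, the power $\tau^k$ fixes all $a$ points if $a\mid k$ and none
otherwise. Points outside the support of $\tau$ are the parts equal to one. -/
theorem card_fixedBy_pow (τ : Equiv.Perm (Fin n)) (k : ℕ) :
    (Finset.univ.filter fun x => (τ ^ k) x = x).card =
      (τ.partition.parts.map fun a => if a ∣ k then a else 0).sum := by
  rw [Equiv.Perm.parts_partition, Multiset.map_add, Multiset.sum_add, Multiset.map_replicate,
    Multiset.sum_replicate, if_pos (one_dvd k), smul_eq_mul, mul_one, Finset.card_filter,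
    ← Finset.sum_add_sum_compl τ.support]
  congr 1
  · rw [Equiv.Perm.cycleType_def, Multiset.map_map]
    change _ = ∑ c ∈ τ.cycleFactorsFinset, _
    -- The points of the support are grouped by the cycle containing them.
    rw [← Finset.sum_fiberwise_of_maps_to (g := τ.cycleOf) (t := τ.cycleFactorsFinset)
      (fun x hx => Equiv.Perm.cycleOf_mem_cycleFactorsFinset_iff.2 hx)]
    refine Finset.sum_congr rfl fun c hc => ?_
    have hs : τ.support.filter (fun x => τ.cycleOf x = c) = c.support := by
      ext x
      rw [Finset.mem_filter, eq_comm (b := c),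
        Equiv.Perm.eq_cycleOf_of_mem_cycleFactorsFinset_iff τ c hc]
      exact and_iff_right_of_imp fun h => Equiv.Perm.mem_cycleFactorsFinset_support_le hc h
    rw [hs, Finset.sum_congr rfl fun x hx => if_congr
      ((Equiv.Perm.isCycleOn_support_of_mem_cycleFactorsFinset hc).pow_apply_eq hx) rfl rfl]
    simp
  · rw [← Finset.card_compl, Finset.card_eq_sum_ones]
    refine Finset.sum_congr rfl fun x hx => if_pos ?_
    rw [Finset.mem_compl, Equiv.Perm.notMem_support] at hx
    exact Equiv.Perm.pow_apply_eq_self_of_apply_eq_self hx k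

theorem cycleCounts_one_eq (τ : Equiv.Perm (Fin n)) :
    cycleCounts τ 1 = (Finset.univ.filter fun x => τ x = x).card := by
  rw [cycleCounts_apply, PNat.one_coe, Equiv.Perm.parts_partition, Multiset.count_add,
    Multiset.count_eq_zero_of_notMem fun h => (Equiv.Perm.one_lt_of_mem_cycleType h).ne rfl,
    zero_add, Multiset.count_replicate_self, ← Finset.card_compl]
  congr 1
  ext x
  simp

/-- This computes $\psi^k$ of the permutation character of $K^n$ at $\tau$ and shows that it depends
only on the cycle type. -/
theorem cycleCounts_pow_one (τ : Equiv.Perm (Fin n)) (k : ℕ) :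
    cycleCounts (τ ^ k) 1 = fixedCount (cycleCounts τ) k := by
  rw [cycleCounts_one_eq, card_fixedBy_pow, Finset.sum_multiset_map_count,
    toFinset_parts_partition, Finset.sum_map]
  refine Finset.sum_congr rfl fun j _ => ?_
  rw [cycleCounts_apply]
  simp only [Function.Embedding.coeFn_mk]
  split_ifs
  · rw [smul_eq_mul, mul_comm]
  · rw [smul_zero]

/-- A translation of `Equiv.Perm.card_of_cycleType_mul_eq`, in which the cycle type omits fixed
points: `L` is the multiset of all parts and `M` that of the parts at least two. -/
theorem card_cycleCounts_eq_mul_zOf (m : ℕ+ →₀ ℕ) (hm : partitionSize m = n) :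
    (Finset.univ.filter fun τ : Equiv.Perm (Fin n) => cycleCounts τ = m).card * zOf m =
      n.factorial := by
  classical
  let L : Multiset ℕ := Finsupp.toMultiset (m.mapDomain PNat.val)
  have hcount : ∀ k : ℕ+, L.count (k : ℕ) = m k := fun k => by
    rw [Finsupp.count_toMultiset, Finsupp.mapDomain_apply PNat.coe_injective]
  have hpos : ∀ a ∈ L, 0 < a := by
    intro a ha
    rw [Finsupp.mem_toMultiset] at ha
    obtain ⟨k, -, rfl⟩ := Finset.mem_image.1 (Finsupp.mapDomain_support ha)
    exact k.pos
  have htoFinset : L.toFinset = m.support.map ⟨PNat.val, PNat.coe_injective⟩ := by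
    rw [Finsupp.toFinset_toMultiset, Finsupp.mapDomain_support_of_injective PNat.coe_injective,
      Finset.map_eq_image]
    rfl
  have hsum : L.sum = n := by
    rw [Finset.sum_multiset_count, htoFinset, Finset.sum_map, ← hm]
    refine Finset.sum_congr rfl fun k _ => ?_
    rw [Function.Embedding.coeFn_mk, hcount, smul_eq_mul, mul_comm]
  let M : Multiset ℕ := L.filter (2 ≤ ·)
  have hone : L.filter (fun a => ¬ 2 ≤ a) = Multiset.replicate (L.count 1) 1 := by
    rw [← Multiset.filter_eq']
    refine Multiset.filter_congr fun a ha => ?_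
    have := hpos a ha
    omega
  have hL : M + Multiset.replicate (L.count 1) 1 = L := by
    rw [← hone]
    exact Multiset.filter_add_not _ _
  have hMsum : M.sum + L.count 1 = n := by
    have := congrArg Multiset.sum hL
    rwa [Multiset.sum_add, Multiset.sum_replicate, smul_eq_mul, mul_one, hsum] at this
  -- The parts equal to one contribute $1^{m_1}m_1!$ to $z_m$, and $m_1=n-\sum M$.
  have hz : zOf m = (n - M.sum).factorial * M.prod *
      ∏ a ∈ M.toFinset, (M.count a).factorial := by
    have h1 : M.prod = L.prod := by
      rw [← hL, Multiset.prod_add, Multiset.prod_replicate, one_pow, mul_one]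
    have h2 : (n - M.sum) = L.count 1 := by omega
    -- Inserting $1$ is harmless even when it is not a part, because $0!=1$.
    have h3 : ∏ a ∈ L.toFinset, (L.count a).factorial =
        ∏ a ∈ insert 1 M.toFinset, (L.count a).factorial := by
      refine Finset.prod_subset (fun a ha => ?_) fun a _ ha => ?_
      · have ha := Multiset.mem_toFinset.1 ha
        have := hpos a ha
        rw [Finset.mem_insert, Multiset.mem_toFinset, Multiset.mem_filter]
        by_cases h : a = 1
        · exact Or.inl h
        · exact Or.inr ⟨ha, by omega⟩
      · rw [Multiset.mem_toFinset] at ha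
        rw [Multiset.count_eq_zero_of_notMem ha, Nat.factorial_zero]
    have h4 : (1 : ℕ) ∉ M.toFinset := by
      rw [Multiset.mem_toFinset, Multiset.mem_filter]
      omega
    have h5 : ∏ a ∈ M.toFinset, (L.count a).factorial =
        ∏ a ∈ M.toFinset, (M.count a).factorial := by
      refine Finset.prod_congr rfl fun a ha => ?_
      rw [Multiset.mem_toFinset, Multiset.mem_filter] at ha
      rw [Multiset.count_filter_of_pos ha.2]
    rw [h1, h2, mul_right_comm, ← h5,
      ← Finset.prod_insert (f := fun a => (L.count a).factorial) h4, ← h3, mul_comm,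
      Finset.prod_multiset_count, ← Finset.prod_mul_distrib, htoFinset, Finset.prod_map]
    refine Finset.prod_congr rfl fun k _ => ?_
    rw [Function.Embedding.coeFn_mk, hcount]
  have hiff : ∀ τ : Equiv.Perm (Fin n), cycleCounts τ = m ↔ τ.cycleType = M := by
    intro τ
    constructor
    · rintro rfl
      rw [← Equiv.Perm.filter_parts_partition_eq_cycleType]
      congr 1
      ext a
      rcases Nat.eq_zero_or_pos a with rfl | ha
      · rw [Multiset.count_eq_zero_of_notMem fun h => (τ.partition.parts_pos h).ne rfl,
          Multiset.count_eq_zero_of_notMem fun h => (hpos _ h).ne rfl]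
      · exact (cycleCounts_apply τ ⟨a, ha⟩).symm.trans (hcount ⟨a, ha⟩).symm
    · intro h
      ext k
      -- The cycle type determines the number of fixed points once $n$ is known.
      have hs : Fintype.card (Fin n) - τ.support.card = L.count 1 := by
        rw [← Equiv.Perm.sum_cycleType, h, Fintype.card_fin]
        omega
      rw [cycleCounts_apply, Equiv.Perm.parts_partition, h, hs, hL, hcount]
  have hcard := Equiv.Perm.card_of_cycleType_mul_eq (Fin n) M
  rw [if_pos ⟨by rw [Fintype.card_fin]; omega, fun a ha => (Multiset.mem_filter.1 ha).2⟩,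
    Fintype.card_fin] at hcard
  rw [hz, Finset.filter_congr fun τ _ => hiff τ]
  exact hcard

end CycleCounts

/-! ### The two sides of the duality -/

section Duality

variable {K : Type*} [Field K] [CharZero K]

theorem scalarProduct_toSeries_right (F : SymSeries K) (g : SymFun K) :
    scalarProduct F (SymFun.toSeries g) = ∑ m ∈ ((powerSumEquiv K).symm g).support,
      (zOf m : K) * powerSumCoeff F m * ((powerSumEquiv K).symm g).coeff m := by
  rw [scalarProduct]
  simp only [powerSumCoeff_toSeries]
  refine finsum_eq_sum_of_support_subset _ fun m hm => ?_
  exact MvPolynomial.mem_support_iff.2 (right_ne_zero_of_mul hm)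

theorem scalarProduct_toSeries_left (f : SymFun K) (G : SymSeries K) :
    scalarProduct (SymFun.toSeries f) G = ∑ m ∈ ((powerSumEquiv K).symm f).support,
      ((powerSumEquiv K).symm f).coeff m * ((zOf m : K) * powerSumCoeff G m) := by
  rw [scalarProduct]
  simp only [powerSumCoeff_toSeries]
  refine (finsum_eq_sum_of_support_subset _ fun m hm => ?_).trans
    (Finset.sum_congr rfl fun m _ => ?_)
  · exact MvPolynomial.mem_support_iff.2 (right_ne_zero_of_mul (left_ne_zero_of_mul hm))
  · rw [mul_comm (zOf m : K), mul_assoc]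

theorem scalarProduct_cyclePowerSum {n : ℕ} (F : SymSeries K) (τ : Equiv.Perm (Fin n)) :
    scalarProduct F (SymFun.toSeries (cyclePowerSum K τ)) =
      (zOf (cycleCounts τ) : K) * powerSumCoeff F (cycleCounts τ) := by
  classical
  rw [scalarProduct_toSeries_right, cyclePowerSum_eq, powerSumEquiv_symm_powerSumHom,
    MvPolynomial.support_monomial, if_neg one_ne_zero, Finset.sum_singleton,
    MvPolynomial.coeff_monomial, if_pos rfl, mul_one]

theorem powerSumSeries_hsymm_one :
    powerSumSeries K (SymFun.toSeries (SymFun.hsymm K 1)) = MvPowerSeries.X 1 := by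
  classical
  have h := nsmul_hsymm (K := K) 1
  rw [one_smul, Finset.sum_range_one, zero_add, Nat.sub_self, SymFun.hsymm_zero, mul_one] at h
  have h1 : SymFun.psum K 1 = powerSumHom K (MvPolynomial.X 1) := by
    rw [powerSumHom, MvPolynomial.aeval_X, PNat.one_coe]
  ext m
  rw [coeff_powerSumSeries, powerSumCoeff_toSeries, h, h1, powerSumEquiv_symm_powerSumHom,
    MvPolynomial.coeff_X, MvPowerSeries.coeff_X]
  exact if_congr eq_comm rfl rfl

/-- Since $h_1=p_1$, the coefficient at $m$ is that of $\sigma_1$ at $m$ with one part $1$ removed.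
By the recursion for the exponential, where $c_1=1$, this is $m_1/z_m$; hence the character counts
fixed points. -/
theorem zOf_mul_powerSumCoeff_sigmaOne_mul_hsymm_one (m : ℕ+ →₀ ℕ) :
    (zOf m : K) * powerSumCoeff (sigmaOne K * SymFun.toSeries (SymFun.hsymm K 1)) m = m 1 := by
  classical
  rw [← coeff_powerSumSeries, map_mul, powerSumSeries_hsymm_one, MvPowerSeries.X,
    MvPowerSeries.coeff_mul_monomial, mul_one, coeff_powerSumSeries, powerSumCoeff_sigmaOne]
  split_ifs with h
  · obtain ⟨m', rfl⟩ : ∃ m', m = m' + Finsupp.single 1 1 :=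
      ⟨m - Finsupp.single 1 1, (tsub_add_cancel_of_le h).symm⟩
    have hrec := expCoeff_add_single (fun k : ℕ+ => ((k : ℕ) : K)⁻¹) m' 1
    simp only [PNat.one_coe, Nat.cast_one, inv_one, one_mul] at hrec
    rw [add_tsub_cancel_right, ← hrec, ← mul_assoc, zOf_mul_expCoeff_inv]
    simp
  · have : m 1 = 0 := by
      rw [Finsupp.single_le_iff] at h
      omega
    rw [this, mul_zero, Nat.cast_zero]

theorem classFunctionOf_sigmaOne_mul_hsymm_one {n : ℕ} (τ : Equiv.Perm (Fin n)) :
    classFunctionOf n (sigmaOne K * SymFun.toSeries (SymFun.hsymm K 1)) τ =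
      (cycleCounts τ 1 : K) := by
  rw [classFunctionOf, scalarProduct_cyclePowerSum, zOf_mul_powerSumCoeff_sigmaOne_mul_hsymm_one]

/-- Products of class functions are pointwise, so evaluation at $\tau$ is an algebra homomorphism
and passes through the polynomial. -/
theorem lambdaOperation_apply (f : SymFun K) {n : ℕ} (ξ : Equiv.Perm (Fin n) → K)
    (τ : Equiv.Perm (Fin n)) :
    lambdaOperation f ξ τ =
      MvPolynomial.aeval (fun k : ℕ+ => ξ (τ ^ (k : ℕ))) ((powerSumEquiv K).symm f) := by
  have h := MvPolynomial.comp_aeval_apply (fun k : ℕ+ => adams k ξ)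
    (Pi.evalAlgHom K (fun _ : Equiv.Perm (Fin n) => K) τ) ((powerSumEquiv K).symm f)
  exact h

/-- The permutations contributing to $p_m$ form the class of type $m$, of size $n!/z_m$, so the
coefficient is $x/z_m$. Constancy of $\xi$ is needed on that class alone. -/
theorem zOf_mul_coeff_frobeniusChar (n : ℕ) (ξ : Equiv.Perm (Fin n) → K) (m : ℕ+ →₀ ℕ)
    (hm : partitionSize m = n) (x : K) (hx : ∀ τ, cycleCounts τ = m → ξ τ = x) :
    (zOf m : K) * MvPolynomial.coeff m ((powerSumEquiv K).symm (frobeniusChar n ξ)) = x := by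
  classical
  have h : MvPolynomial.coeff m ((powerSumEquiv K).symm (frobeniusChar n ξ)) =
      (n.factorial : K)⁻¹ *
        ((Finset.univ.filter fun τ : Equiv.Perm (Fin n) => cycleCounts τ = m).card * x) := by
    rw [frobeniusChar, map_smul, MvPolynomial.coeff_smul, smul_eq_mul, map_sum,
      MvPolynomial.coeff_sum, ← nsmul_eq_mul, ← Finset.sum_const, Finset.sum_filter]
    congr 1
    refine Finset.sum_congr rfl fun τ _ => ?_
    rw [map_smul, cyclePowerSum_eq, powerSumEquiv_symm_powerSumHom, MvPolynomial.coeff_smul,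
      MvPolynomial.coeff_monomial, smul_eq_mul]
    split_ifs with hτ
    · rw [hx τ hτ, mul_one]
    · rw [mul_zero]
  have hn : (n.factorial : K) ≠ 0 := by exact_mod_cast n.factorial_ne_zero
  rw [h, ← mul_assoc, ← mul_assoc, mul_comm (zOf m : K), mul_assoc (n.factorial : K)⁻¹,
    mul_comm (zOf m : K), ← Nat.cast_mul, card_cycleCounts_eq_mul_zOf m hm, inv_mul_cancel₀ hn,
    one_mul]

theorem zOf_mul_powerSumCoeff_innerPlethysm (f : SymFun K) (m : ℕ+ →₀ ℕ) :
    (zOf m : K) * powerSumCoeff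
        (innerPlethysm f (sigmaOne K * SymFun.toSeries (SymFun.hsymm K 1))) m =
      MvPolynomial.aeval (fun k : ℕ+ => (fixedCount m k : K)) ((powerSumEquiv K).symm f) := by
  set F := sigmaOne K * SymFun.toSeries (SymFun.hsymm K 1)
  have h : powerSumCoeff (innerPlethysm f F) m =
      powerSumCoeff (SymFun.toSeries (frobeniusChar (partitionSize m)
        (lambdaOperation f (classFunctionOf (partitionSize m) F)))) m := by
    -- Of all the components of the inner plethysm, only the one with $n=|m|$ matters.
    refine powerSumCoeff_congr fun d hd => ?_
    rw [← hd]
    rfl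
  rw [h, powerSumCoeff_toSeries]
  refine zOf_mul_coeff_frobeniusChar _ _ m rfl _ fun τ hτ => ?_
  rw [lambdaOperation_apply]
  congr 2
  ext k
  rw [classFunctionOf_sigmaOne_mul_hsymm_one, cycleCounts_pow_one, hτ]

/-- For each monomial $p_m$ of $g$, the product of the exponentials $p_j[\sigma_1]^{m_j}$ adds the
exponents; the coefficient of $p_k$ becomes $\sum_{j\mid k}j\,m_j/k$, whose numerator is
`fixedCount`. -/
theorem powerSumSeries_outerPlethysm_sigmaOne (g : SymFun K) :
    powerSumSeries K (outerPlethysm g (sigmaOne K)) =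
      ∑ m ∈ ((powerSumEquiv K).symm g).support,
        ((powerSumEquiv K).symm g).coeff m • expSeries fun k => (fixedCount m k : K) * ((k : ℕ) : K)⁻¹ := by
  have h := MvPolynomial.comp_aeval_apply (fun k : ℕ+ => SymSeries.powerSubst k (sigmaOne K))
    (powerSumSeries K) ((powerSumEquiv K).symm g)
  rw [outerPlethysm, h, MvPolynomial.aeval_def, MvPolynomial.eval₂_eq]
  refine Finset.sum_congr rfl fun m _ => ?_
  rw [Algebra.smul_def]
  congr 1
  simp only [powerSumSeries_powerSubst_sigmaOne, ← expSeries_nsmul, ← expSeries_sum]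
  congr 1
  ext k
  rw [Finset.sum_apply, fixedCount, Finsupp.sum, Nat.cast_sum, Finset.sum_mul]
  refine Finset.sum_congr rfl fun j _ => ?_
  rw [Pi.smul_apply, nsmul_eq_mul]
  split_ifs
  · push_cast
    ring
  · simp

theorem zOf_mul_powerSumCoeff_outerPlethysm_sigmaOne (g : SymFun K) (m : ℕ+ →₀ ℕ) :
    (zOf m : K) * powerSumCoeff (outerPlethysm g (sigmaOne K)) m =
      ∑ l ∈ ((powerSumEquiv K).symm g).support,
        ((powerSumEquiv K).symm g).coeff l * m.prod fun k e => (fixedCount l k : K) ^ e := by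
  rw [← coeff_powerSumSeries, powerSumSeries_outerPlethysm_sigmaOne, map_sum,
    Finset.mul_sum]
  refine Finset.sum_congr rfl fun l _ => ?_
  rw [map_smul, smul_eq_mul, coeff_expSeries, mul_left_comm, zOf_mul_expCoeff]
  congr 1
  refine Finset.prod_congr rfl fun k _ => ?_
  have hk : ((k : ℕ) : K) ≠ 0 := by exact_mod_cast k.ne_zero
  beta_reduce
  rw [mul_left_comm, mul_inv_cancel₀ hk, mul_one]

end Duality

end

theorem mainTheorem1 {K : Type*} [Field K] [CharZero K] (f g : SymFun K) :
    scalarProduct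
        (innerPlethysm f (sigmaOne K * SymFun.toSeries (SymFun.hsymm K 1)))
        (SymFun.toSeries g) =
      scalarProduct (SymFun.toSeries f) (outerPlethysm g (sigmaOne K)) := by
  rw [scalarProduct_toSeries_right, scalarProduct_toSeries_left]
  simp only [zOf_mul_powerSumCoeff_innerPlethysm, zOf_mul_powerSumCoeff_outerPlethysm_sigmaOne,
    MvPolynomial.aeval_def, MvPolynomial.eval₂_eq, Finset.sum_mul, Finset.mul_sum]
  -- Both sides are now double sums, over the monomials of $f$ and of $g$, of the same product of
  -- fixed-point counts; only the order of summation differs.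
  rw [Finset.sum_comm]
  refine Finset.sum_congr rfl fun m _ => Finset.sum_congr rfl fun l _ => ?_
  rw [Algebra.algebraMap_self, RingHom.id_apply, mul_assoc, mul_comm (Finset.prod _ _)]
  rfl
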